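/- For a matrix $A\in\mathbb{R}^{n\times m}$ let $\|A\|_\infty$ be the largest $\ell_1$ norm of a row and $\mathrm{nnz}(A)$ the number of nonzero entries. Assume $n\ge 1$, $\mathrm{nnz}(A)\ge n$, that every column of $A$ has at most $c$ nonzero entries, and let $b\in\mathbb{R}^n$, $r>0$, $\epsilon>0$. The model of computation is a randomized real RAM (unit-cost exact real arithmetic including $\exp$ and $\log$, comparisons, array access, and uniform random reals in $[0,1]$); $A$ is given in compressed sparse column format. "In time $\tilde O(f)$" means: within $C f\log^k(2+f)$ steps on every outcome of the random bits, and "with high probability" means: with probability at least $1-(n+m)^{-K}$, where $K\in\mathbb{N}$ is any fixed constant, and the program and $C,k$ depend only on $K$. (1) There is an algorithm which, given $A,b,r,\epsilon$, finds with high probability an $\epsilon$-approximate minimizer of the box-constrained $\ell_\infty$ regression problem $\min_{x\in[-r,r]^m}\|Ax-b\|_\infty$, i.e. a point $x\in[-r,r]^m$ with $\|Ax-b\|_\infty\le\min_{y\in[-r,r]^m}\|Ay-b\|_\infty+\epsilon$, in time $$\tilde O\bigl(mc\cdot\max(1,\,r\|A\|_\infty/\epsilon)\bigr);$$ for $\epsilon\le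 r\|A\|_\infty$ this is $\tilde O(mcr\|A\|_\infty/\epsilon)$. (2) There is an algorithm which, given $A,b,r,\epsilon$ and a point $x_0\in\mathbb{R}^m$ such that $\|x_0-x^*\|_\infty\le r$ for some minimizer $x^*$ of $\|Ax-b\|_\infty$ over $\mathbb{R}^m$, finds with high probability a point $x\in\mathbb{R}^m$ with $\|Ax-b\|_\infty\le\|Ax^*-b\|_\infty+\epsilon$ within the same time bound. -/

import Mathlib

open MeasureTheory
open scoped Matrix

-- On matrices, `‖A‖` is the operator norm induced by the sup norm: the largest ℓ₁ norm of a row.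
attribute [local instance] Matrix.linftyOpNormedAddCommGroup

namespace LinfReg

/-! ### A randomized real RAM

Programs work on natural-number and real variables and on finitely many named arrays of either
kind (names are numerals fixed in the program text; array indices are computed at run time).
Every arithmetic operation, comparison, memory access, coin toss and control transfer costs one
unit of time.  Real arithmetic is exact and comprises field operations, `exp` and `log`; there is
no rounding from reals to naturals, and the only numerals are natural numbers. -/

/-- Memory of the machine, with the supply of independent random reals in `[0,1]`. -/
structure State where
  nvar : ℕ → ℕ
  rvar : ℕ → ℝ
  narr : ℕ → ℕ → ℕ
  rarr : ℕ → ℕ → ℝ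
  coins : ℕ → unitInterval

/-- Expressions of natural-number type. -/
inductive NExp where
  | lit (k : ℕ)
  | var (a : ℕ)
  | get (a : ℕ) (i : NExp)
  | add (e f : NExp)
  | sub (e f : NExp)
  | half (e : NExp)

/-- Truncated subtraction and halving with rounding down. -/
def NExp.eval (s : State) : NExp → ℕ
  | lit k => k
  | var a => s.nvar a
  | get a i => s.narr a (i.eval s)
  | add e f => e.eval s + f.eval s
  | sub e f => e.eval s - f.eval s
  | half e => e.eval s / 2

/-- Number of elementary operations needed to evaluate an expression. -/
def NExp.cost : NExp → ℕ
  | lit _ => 1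
  | var _ => 1
  | get _ i => i.cost + 1
  | add e f => e.cost + f.cost + 1
  | sub e f => e.cost + f.cost + 1
  | half e => e.cost + 1

/-- Expressions of real type. -/
inductive RExp where
  | ofNat (e : NExp)
  | var (a : ℕ)
  | get (a : ℕ) (i : NExp)
  | add (e f : RExp)
  | sub (e f : RExp)
  | mul (e f : RExp)
  | div (e f : RExp)
  | exp (e : RExp)
  | log (e : RExp)

/-- Undefined quotients and logarithms return the default values of Lean's functions; a program
can test for these cases beforehand. -/
noncomputable def RExp.eval (s : State) : RExp → ℝ
  | ofNat e => (e.eval s : ℝ)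
  | var a => s.rvar a
  | get a i => s.rarr a (i.eval s)
  | add e f => e.eval s + f.eval s
  | sub e f => e.eval s - f.eval s
  | mul e f => e.eval s * f.eval s
  | div e f => e.eval s / f.eval s
  | exp e => Real.exp (e.eval s)
  | log e => Real.log (e.eval s)

/-- Number of elementary operations needed to evaluate an expression. -/
def RExp.cost : RExp → ℕ
  | ofNat e => e.cost + 1
  | var _ => 1
  | get _ i => i.cost + 1
  | add e f => e.cost + f.cost + 1
  | sub e f => e.cost + f.cost + 1
  | mul e f => e.cost + f.cost + 1
  | div e f => e.cost + f.cost + 1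
  | exp e => e.cost + 1
  | log e => e.cost + 1

/-- Tests. -/
inductive Test where
  | nlt (e f : NExp)
  | rlt (e f : RExp)
  | not (t : Test)
  | and (t u : Test)

def Test.Holds (s : State) : Test → Prop
  | nlt e f => e.eval s < f.eval s
  | rlt e f => e.eval s < f.eval s
  | not t => ¬ t.Holds s
  | and t u => t.Holds s ∧ u.Holds s

/-- Number of elementary operations needed to evaluate a test. -/
def Test.cost : Test → ℕ
  | nlt e f => e.cost + f.cost + 1
  | rlt e f => e.cost + f.cost + 1
  | not t => t.cost + 1
  | and t u => t.cost + u.cost + 1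

/-- Programs. -/
inductive Prog where
  | skip
  | nset (a : ℕ) (e : NExp)
  | rset (a : ℕ) (e : RExp)
  | nput (a : ℕ) (i : NExp) (e : NExp)
  | rput (a : ℕ) (i : NExp) (e : RExp)
  | toss (a : ℕ)
  | seq (p q : Prog)
  | ite (t : Test) (p q : Prog)
  | loop (t : Test) (p : Prog)

/-- Store a value in a variable or in an array cell. -/
def State.nset (s : State) (a v : ℕ) : State :=
  { s with nvar := Function.update s.nvar a v }

def State.rset (s : State) (a : ℕ) (v : ℝ) : State :=
  { s with rvar := Function.update s.rvar a v }

def State.nput (s : State) (a i v : ℕ) : State :=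
  { s with narr := Function.update s.narr a (Function.update (s.narr a) i v) }

def State.rput (s : State) (a i : ℕ) (v : ℝ) : State :=
  { s with rarr := Function.update s.rarr a (Function.update (s.rarr a) i v) }

/-- Store the next random real in a variable. -/
def State.toss (s : State) (a : ℕ) : State :=
  { s.rset a (s.coins 0 : ℝ) with coins := fun k => s.coins (k + 1) }

/-- `Exec p s s' T`: program `p`, started in `s`, halts in `s'` after `T` units of time. -/
inductive Exec : Prog → State → State → ℕ → Prop where
  | skip (s : State) : Exec .skip s s 1
  | nset (s : State) (a : ℕ) (e : NExp) :
      Exec (.nset a e) s (s.nset a (e.eval s)) (e.cost + 1)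
  | rset (s : State) (a : ℕ) (e : RExp) :
      Exec (.rset a e) s (s.rset a (e.eval s)) (e.cost + 1)
  | nput (s : State) (a : ℕ) (i e : NExp) :
      Exec (.nput a i e) s (s.nput a (i.eval s) (e.eval s)) (i.cost + e.cost + 1)
  | rput (s : State) (a : ℕ) (i : NExp) (e : RExp) :
      Exec (.rput a i e) s (s.rput a (i.eval s) (e.eval s)) (i.cost + e.cost + 1)
  | toss (s : State) (a : ℕ) : Exec (.toss a) s (s.toss a) 1
  | seq {p q : Prog} {s s' s'' : State} {T U : ℕ} :
      Exec p s s' T → Exec q s' s'' U → Exec (.seq p q) s s'' (T + U)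
  | ite_true {t : Test} {p q : Prog} {s s' : State} {T : ℕ} :
      t.Holds s → Exec p s s' T → Exec (.ite t p q) s s' (t.cost + T + 1)
  | ite_false {t : Test} {p q : Prog} {s s' : State} {T : ℕ} :
      ¬ t.Holds s → Exec q s s' T → Exec (.ite t p q) s s' (t.cost + T + 1)
  | loop_true {t : Test} {p : Prog} {s s' s'' : State} {T U : ℕ} :
      t.Holds s → Exec p s s' T → Exec (.loop t p) s' s'' U →
        Exec (.loop t p) s s'' (t.cost + T + U + 1)
  | loop_false {t : Test} {p : Prog} {s : State} :
      ¬ t.Holds s → Exec (.loop t p) s s (t.cost + 1)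

/-- Independent uniform random reals in `[0,1]`. -/
noncomputable def coinMeasure : Measure (ℕ → unitInterval) :=
  Measure.infinitePi fun _ => (volume : Measure unitInterval)

/-- On every outcome of the coins, `p` halts within time `T`; and the outcomes for which its final
state is not `Good` have probability at most `δ`. -/
def SolvesWithin (p : Prog) (init : (ℕ → unitInterval) → State) (T : ℝ) (δ : ENNReal)
    (Good : State → Prop) : Prop :=
  (∀ ω, ∃ s' t, Exec p (init ω) s' t ∧ (t : ℝ) ≤ T) ∧
    coinMeasure {ω | ¬ ∃ s' t, Exec p (init ω) s' t ∧ Good s'} ≤ δ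

/-- The bound `C · f · logᵏ f` of soft-O notation (`2 + f` keeps the logarithm away from `0`). -/
noncomputable def softBound (C : ℝ) (k : ℕ) (f : ℝ) : ℝ := C * f * Real.log (2 + f) ^ k

/-! ### Input and output -/

/-- Number of nonzero entries of column `j`. -/
noncomputable def colNnz {n m : ℕ} (A : Matrix (Fin n) (Fin m) ℝ) (j : Fin m) : ℕ :=
  {i : Fin n | A i j ≠ 0}.ncard

/-- Number of nonzero entries. -/
noncomputable def nnz {n m : ℕ} (A : Matrix (Fin n) (Fin m) ℝ) : ℕ :=
  ∑ j, colNnz A j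

/-- Compressed sparse column format: the nonzero entries of column `j`, in any order and each
once, occupy the positions `colPtr j ≤ k < colPtr (j + 1)`. -/
structure CSC {n m : ℕ} (A : Matrix (Fin n) (Fin m) ℝ) where
  colPtr : ℕ → ℕ
  rowIdx : ℕ → ℕ
  val : ℕ → ℝ
  colPtr_zero : colPtr 0 = 0
  colPtr_le : ∀ j : Fin m, colPtr j ≤ colPtr (j + 1)
  sound : ∀ (j : Fin m) (k : ℕ), colPtr j ≤ k → k < colPtr (j + 1) →
    ∃ i : Fin n, rowIdx k = i ∧ val k = A i j ∧ A i j ≠ 0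
  complete : ∀ (j : Fin m) (i : Fin n), A i j ≠ 0 →
    ∃! k : ℕ, colPtr j ≤ k ∧ k < colPtr (j + 1) ∧ rowIdx k = i

/-- A vector as the beginning of an array, followed by zeros. -/
def pad {d : ℕ} (v : Fin d → ℝ) (i : ℕ) : ℝ := if h : i < d then v ⟨i, h⟩ else 0

/-- Initial memory: the dimensions, the scalars `r` and `ε`, the sparse matrix, `b` and a point
`x₀` in the first variables and arrays of their kind; everything else is zero. -/
noncomputable def initState {n m : ℕ} {A : Matrix (Fin n) (Fin m) ℝ} (D : CSC A)
    (b : Fin n → ℝ) (r ε : ℝ) (x₀ : Fin m → ℝ) (ω : ℕ → unitInterval) : State where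
  nvar
    | 0 => n
    | 1 => m
    | _ => 0
  rvar
    | 0 => r
    | 1 => ε
    | _ => 0
  narr
    | 0 => D.colPtr
    | 1 => D.rowIdx
    | _ => fun _ => 0
  rarr
    | 0 => D.val
    | 1 => pad b
    | 2 => pad x₀
    | _ => fun _ => 0
  coins := ω

/-- The result is read off from the first `m` cells of real array number `3`. -/
def output (m : ℕ) (s : State) : Fin m → ℝ := fun j => s.rarr 3 j

/-- `x` is a point of `S` where `f` is within `ε` of its minimum over `S`. -/
def IsApproxMin {X : Type*} (f : X → ℝ) (S : Set X) (ε : ℝ) (x : X) : Prop :=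
  x ∈ S ∧ ∀ y ∈ S, f x ≤ f y + ε

end LinfReg

/-!
The substitution `x = x₀ + r u` and division by `r ‖A‖` turn the problem into the minimization of
`‖B u - β‖` over the unit box for a matrix of norm `1`, that is, into a box-simplex game with the
payoff `⟨y, M u + d⟩`, where the rows of `M` are those of `B` with both signs.

Both players follow optimistic dual averaging with the regularizer `⟨y, |M| u²⟩ + 120 ∑ y log y`.
Each player's step has a closed form, one being taken after the other. As the weights change by a
factor of at most `2` from one round to the next, the error terms of a round are absorbed by the
relative entropy and the weighted squares which the previous rounds gain. The range of the
regularizer is `O(log n)`, so the average of the box player's strategies is optimal up to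
`O(log n / T)` after `T` rounds, and `T = O(log n · r ‖A‖ / ε)` rounds suffice. A round multiplies
vectors with `M` and `|M|`, which takes time linear in `n + m + nnz A = O(m c)`. The method uses no
random numbers and never fails.
-/

namespace LinfReg

section Scalar

/-- Projection of a real number to `[-1,1]`. -/
noncomputable def clip (t : ℝ) : ℝ := max (-1) (min t 1)

theorem abs_clip_le (t : ℝ) : |clip t| ≤ 1 :=
  abs_le.2 ⟨le_max_left _ _, max_le (by norm_num) (min_le_right _ _)⟩

theorem clip_sub_mul_sub_clip_nonneg (t : ℝ) {x : ℝ} (hx : |x| ≤ 1) :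
    0 ≤ (clip t - t) * (x - clip t) := by
  obtain ⟨neg_one_le, le_one⟩ := abs_le.1 hx
  unfold clip
  rcases le_total t 1 with ht | ht
  · rw [min_eq_left ht]
    rcases le_total (-1) t with ht' | ht'
    · simp [max_eq_right ht']
    · rw [max_eq_left ht']; exact mul_nonneg (by linarith) (by linarith)
  · rw [min_eq_right ht, max_eq_right (by norm_num)]
    exact mul_nonneg_of_nonpos_of_nonpos (by linarith) (by linarith)

/-- First-order optimality of the minimizer of `p x + w x²` over `[-1,1]`. If `w = 0`, every point
of the interval is a minimizer, so the junk value of the quotient does no harm. -/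
theorem clip_optimal {p w x : ℝ} (hw : 0 ≤ w) (hp : w = 0 → p = 0) (hx : |x| ≤ 1) :
    0 ≤ (p + 2 * w * clip (-p / (2 * w))) * (x - clip (-p / (2 * w))) := by
  rcases hw.eq_or_lt with h | h
  · simp [← h, hp h.symm]
  calc 0 ≤ 2 * w * ((clip (-p / (2 * w)) - -p / (2 * w)) * (x - clip (-p / (2 * w)))) :=
        mul_nonneg (by positivity) (clip_sub_mul_sub_clip_nonneg _ hx)
    _ = _ := by field_simp; ring

theorem mul_le_sq_div_add {a y : ℝ} (ha : 0 < a) (hy : 0 < y) (u e : ℝ) :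
    u * e ≤ a * (u ^ 2 / y) + y * e ^ 2 / (4 * a) := by
  have : 0 ≤ (2 * a * u - y * e) ^ 2 / (4 * a * y) := by positivity
  have expand : (2 * a * u - y * e) ^ 2 / (4 * a * y)
      = a * (u ^ 2 / y) + y * e ^ 2 / (4 * a) - u * e := by field_simp; ring
  linarith

theorem sq_sqrt_sub_sqrt_le {a b : ℝ} (ha : 0 ≤ a) (hb : 0 < b) :
    (√a - √b) ^ 2 ≤ a * Real.log a - a * Real.log b - a + b := by
  rcases ha.eq_or_lt with rfl | ha
  · simp [Real.sq_sqrt hb.le]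
  have log_le := Real.log_le_sub_one_of_pos (x := √(b / a)) (by positivity)
  rw [Real.log_sqrt (by positivity), Real.log_div hb.ne' ha.ne', Real.sqrt_div hb.le] at log_le
  have mul_div : a * (√b / √a) = √a * √b := by
    have := Real.sqrt_pos.2 ha
    field_simp
    rw [Real.sq_sqrt ha.le]
  nlinarith [Real.sq_sqrt ha.le, Real.sq_sqrt hb.le]

theorem sub_le_mul_log_sub_mul_log {a b : ℝ} (ha : 0 ≤ a) (hb : 0 < b) :
    a - b ≤ a * Real.log a - a * Real.log b := by
  linarith [sq_sqrt_sub_sqrt_le ha hb, sq_nonneg (√a - √b)]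

theorem sq_sub_div_le {a b : ℝ} (ha : 0 < a) (hb : 0 < b) (h : b ≤ 2 * a) :
    (a - b) ^ 2 / a ≤ 6 * (a * Real.log a - a * Real.log b - a + b) := by
  refine le_trans ?_ (mul_le_mul_of_nonneg_left (sq_sqrt_sub_sqrt_le ha.le hb) (by norm_num))
  have sq_a := Real.sq_sqrt ha.le
  have sq_b := Real.sq_sqrt hb.le
  have factor : (a - b) ^ 2 = (√a - √b) ^ 2 * (√a + √b) ^ 2 := by
    rw [← mul_pow, show (√a - √b) * (√a + √b) = √a ^ 2 - √b ^ 2 by ring, sq_a, sq_b]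
  have sq_add_le : (√a + √b) ^ 2 ≤ 6 * a := by nlinarith [sq_nonneg (√a - √b)]
  rw [div_le_iff₀ ha, factor]
  nlinarith [mul_le_mul_of_nonneg_left sq_add_le (sq_nonneg (√a - √b))]

/-- The inequality behind `variation_le`, for one row: `u` and `v` are the last two changes of its
weight `y₂`, and `e`, `e₀` those of its payoff. -/
theorem row_variation_le {y₁ y₂ u v e e₀ Q Q₀ k : ℝ} (hy₁ : 0 < y₁) (hy₂ : 0 < y₂)
    (h₁₂ : y₁ ≤ 2 * y₂) (h₂₁ : y₂ ≤ 2 * y₁) (hQ : e ^ 2 ≤ Q) (hQ₀ : e₀ ^ 2 ≤ Q₀)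
    (hk : u ^ 2 / y₂ ≤ 6 * k) :
    y₂ * Q / 8 + 12 * (u ^ 2 / y₂) + 2 * u * e + 3 * (v * e) + u * e₀
      ≤ 120 * k + y₂ * Q + y₁ * Q₀ / 8 + 12 * (v ^ 2 / y₁) := by
  have weight_v : v ^ 2 / (2 * y₂) ≤ v ^ 2 / y₁ := by gcongr
  rw [mul_comm, ← div_div] at weight_v
  have weight_e₀ : y₂ * e₀ ^ 2 ≤ 2 * y₁ * e₀ ^ 2 := by gcongr
  linarith [mul_le_sq_div_add two_pos hy₂ u e, mul_le_sq_div_add four_pos hy₂ u e₀,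
    mul_le_sq_div_add two_pos hy₂ v e, mul_nonneg hy₂.le (sq_nonneg e),
    mul_le_mul_of_nonneg_left hQ hy₂.le, mul_le_mul_of_nonneg_left hQ₀ hy₁.le]

end Scalar

section Matrix

variable {I J : Type*} [Fintype J]

theorem mulVec_map_abs_nonneg (M : Matrix I J ℝ) {x : J → ℝ} (hx : 0 ≤ x) (i : I) :
    0 ≤ (M.map abs *ᵥ x) i :=
  Finset.sum_nonneg fun j _ => mul_nonneg (abs_nonneg _) (hx j)

theorem abs_mulVec_le (M : Matrix I J ℝ) (x : J → ℝ) (i : I) :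
    |(M *ᵥ x) i| ≤ (M.map abs *ᵥ |x|) i :=
  (Finset.abs_sum_le_sum_abs _ _).trans_eq (Finset.sum_congr rfl fun _ _ => abs_mul _ _)

theorem abs_map_abs_mulVec_mul_le (M : Matrix I J ℝ) {x : J → ℝ} (hx : ‖x‖ ≤ 1) (z : J → ℝ)
    (i : I) : |(M.map abs *ᵥ (x * z)) i| ≤ (M.map abs *ᵥ |z|) i := by
  refine (Finset.abs_sum_le_sum_abs _ _).trans (Finset.sum_le_sum fun j _ => ?_)
  simp only [abs_mul, Matrix.map_apply, abs_abs, Pi.mul_apply, Pi.abs_apply]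
  have : |x j| ≤ 1 := (norm_le_pi_norm x j).trans hx
  gcongr
  exact mul_le_of_le_one_left (abs_nonneg _) this

variable [Fintype I]

theorem norm_map_abs (M : Matrix I J ℝ) : ‖M.map abs‖ = ‖M‖ := by
  simp [Matrix.linfty_opNorm_def]

theorem sum_abs_le_norm (M : Matrix I J ℝ) (i : I) : ∑ j, |M i j| ≤ ‖M‖ := by
  have := Finset.le_sup (f := fun i => ∑ j, ‖M i j‖₊) (Finset.mem_univ i)
  rw [Matrix.linfty_opNorm_def]
  simpa using NNReal.coe_le_coe.2 this

theorem norm_mulVec_le {M : Matrix I J ℝ} (hM : ‖M‖ ≤ 1) (x : J → ℝ) : ‖M *ᵥ x‖ ≤ ‖x‖ :=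
  (Matrix.linfty_opNorm_mulVec M x).trans (mul_le_of_le_one_left (norm_nonneg x) hM)

theorem norm_map_abs_mulVec_le {M : Matrix I J ℝ} (hM : ‖M‖ ≤ 1) (x : J → ℝ) :
    ‖M.map abs *ᵥ x‖ ≤ ‖x‖ :=
  norm_mulVec_le ((norm_map_abs M).trans_le hM) x

theorem sq_map_abs_mulVec_abs_le {M : Matrix I J ℝ} (hM : ‖M‖ ≤ 1) (x : J → ℝ) (i : I) :
    (M.map abs *ᵥ |x|) i ^ 2 ≤ (M.map abs *ᵥ (x * x)) i := by
  have cauchy_schwarz := Finset.sum_sq_le_sum_mul_sum_of_sq_le_mul Finset.univ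
    (r := fun j => |M i j| * |x j|) (f := fun j => |M i j|) (g := fun j => |M i j| * (x j * x j))
    (fun j _ => abs_nonneg _) (fun j _ => mul_nonneg (abs_nonneg _) (mul_self_nonneg _))
    (fun j _ => by rw [mul_pow, sq_abs (x j)]; exact le_of_eq (by ring))
  refine cauchy_schwarz.trans (mul_le_of_le_one_left ?_ ((sum_abs_le_norm M i).trans hM))
  exact mulVec_map_abs_nonneg M (fun j => mul_self_nonneg _) i

theorem norm_mul_self_le_one {x : J → ℝ} (hx : ‖x‖ ≤ 1) : ‖x * x‖ ≤ 1 :=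
  (norm_mul_le x x).trans (mul_le_one₀ hx (norm_nonneg x) hx)

theorem map_abs_mulVec_mul_self_le_one {M : Matrix I J ℝ} (hM : ‖M‖ ≤ 1) {x : J → ℝ}
    (hx : ‖x‖ ≤ 1) (i : I) : (M.map abs *ᵥ (x * x)) i ≤ 1 :=
  (le_abs_self _).trans <| (norm_le_pi_norm (M.map abs *ᵥ (x * x)) i).trans <|
    (norm_map_abs_mulVec_le hM _).trans (norm_mul_self_le_one hx)

theorem abs_dotProduct_le_norm {y : I → ℝ} (hy : y ∈ stdSimplex ℝ I) (v : I → ℝ) :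
    |y ⬝ᵥ v| ≤ ‖v‖ := by
  calc |y ⬝ᵥ v| ≤ ∑ i, |y i * v i| := Finset.abs_sum_le_sum_abs _ _
    _ ≤ ∑ i, y i * ‖v‖ := Finset.sum_le_sum fun i _ => by
        rw [abs_mul, abs_of_nonneg (hy.1 i)]
        exact mul_le_mul_of_nonneg_left (norm_le_pi_norm v i) (hy.1 i)
    _ = ‖v‖ := by rw [← Finset.sum_mul, hy.2, one_mul]

theorem dotProduct_map_abs_mulVec_mul_self_nonneg (M : Matrix I J ℝ) {y : I → ℝ} (hy : 0 ≤ y)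
    (x : J → ℝ) : 0 ≤ y ⬝ᵥ M.map abs *ᵥ (x * x) :=
  dotProduct_nonneg_of_nonneg hy (mulVec_map_abs_nonneg M fun j => mul_self_nonneg (x j))

end Matrix

section Entropy

variable {I : Type*} [Fintype I]

/-- The Gibbs distribution with logits `f`. -/
noncomputable def softmax (f : I → ℝ) (i : I) : ℝ := Real.exp (f i) / ∑ k, Real.exp (f k)

/-- The relative entropy (Kullback–Leibler divergence) of `y` with respect to `z`. -/
noncomputable def relEntropy (y z : I → ℝ) : ℝ :=
  ∑ i, (y i * Real.log (y i) - y i * Real.log (z i))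

theorem relEntropy_nonneg {y z : I → ℝ} (hy : y ∈ stdSimplex ℝ I) (hz : ∀ i, 0 < z i)
    (hz_sum : ∑ i, z i = 1) : 0 ≤ relEntropy y z := by
  calc 0 = ∑ i, (y i - z i) := by rw [Finset.sum_sub_distrib, hy.2, hz_sum, sub_self]
    _ ≤ relEntropy y z := Finset.sum_le_sum fun i _ => sub_le_mul_log_sub_mul_log (hy.1 i) (hz i)

variable [Nonempty I]

theorem neg_log_card_le_sum_mul_log {y : I → ℝ} (hy : y ∈ stdSimplex ℝ I) :
    -Real.log (Fintype.card I) ≤ ∑ i, y i * Real.log (y i) := by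
  have card_pos : (0 : ℝ) < Fintype.card I := by exact_mod_cast Fintype.card_pos
  have := relEntropy_nonneg (z := fun _ => (Fintype.card I : ℝ)⁻¹) hy
    (fun _ => by positivity) (by simp [card_pos.ne'])
  simp only [relEntropy, Finset.sum_sub_distrib, ← Finset.sum_mul, hy.2, Real.log_inv] at this
  linarith

theorem sum_exp_pos (f : I → ℝ) : 0 < ∑ k, Real.exp (f k) :=
  Finset.sum_pos (fun _ _ => Real.exp_pos _) Finset.univ_nonempty

theorem softmax_pos (f : I → ℝ) (i : I) : 0 < softmax f i :=
  div_pos (Real.exp_pos _) (sum_exp_pos f)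

theorem softmax_mem_stdSimplex (f : I → ℝ) : softmax f ∈ stdSimplex ℝ I := by
  refine ⟨fun i => (softmax_pos f i).le, ?_⟩
  simp only [softmax, ← Finset.sum_div]
  exact div_self (sum_exp_pos f).ne'

theorem log_softmax (f : I → ℝ) (i : I) :
    Real.log (softmax f i) = f i - Real.log (∑ k, Real.exp (f k)) := by
  rw [softmax, Real.log_div (Real.exp_pos _).ne' (sum_exp_pos f).ne', Real.log_exp]

theorem softmax_le_exp_mul {f g : I → ℝ} {δ : ℝ} (h : ∀ i, |f i - g i| ≤ δ) (i : I) :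
    softmax f i ≤ Real.exp (2 * δ) * softmax g i := by
  have numerator : Real.exp (f i) ≤ Real.exp δ * Real.exp (g i) := by
    rw [← Real.exp_add]; exact Real.exp_le_exp.2 (by linarith [(abs_le.1 (h i)).2])
  have denominator : ∑ k, Real.exp (g k) ≤ Real.exp δ * ∑ k, Real.exp (f k) := by
    rw [Finset.mul_sum]
    refine Finset.sum_le_sum fun k _ => ?_
    rw [← Real.exp_add]; exact Real.exp_le_exp.2 (by linarith [(abs_le.1 (h k)).1])
  unfold softmax
  rw [← mul_div_assoc, div_le_div_iff₀ (sum_exp_pos f) (sum_exp_pos g)]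
  calc Real.exp (f i) * ∑ k, Real.exp (g k)
      ≤ (Real.exp δ * Real.exp (g i)) * (Real.exp δ * ∑ k, Real.exp (f k)) := by
        have := sum_exp_pos g
        gcongr
    _ = Real.exp (2 * δ) * Real.exp (g i) * ∑ k, Real.exp (f k) := by
        rw [two_mul, Real.exp_add]; ring

theorem softmax_le_two_mul {f g : I → ℝ} (h : ∀ i, |f i - g i| ≤ 1 / 20) (i : I) :
    softmax f i ≤ 2 * softmax g i := by
  have exp_le : Real.exp (2 * (1 / 20)) ≤ 2 := by
    have := Real.exp_bound_div_one_sub_of_interval (x := 1 / 10) (by norm_num) (by norm_num)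
    norm_num at this ⊢
    linarith
  exact (softmax_le_exp_mul h i).trans
    (mul_le_mul_of_nonneg_right exp_le (softmax_pos g i).le)

end Entropy

section Game

variable {I J : Type*} [Fintype I] [Fintype J]

/-- The regularizer `⟨y, |M| x²⟩ + 120 ∑ y log y`: it is jointly area convex rather than strongly
convex in `x`, which is what avoids a dependence of the range on the dimension. -/
noncomputable def reg (M : Matrix I J ℝ) (x : J → ℝ) (y : I → ℝ) : ℝ :=
  y ⬝ᵥ M.map abs *ᵥ (x * x) + 120 * ∑ i, y i * Real.log (y i)

/-- The regularized linear function with the gradients `π ᵥ* M` in `x` and `-θ` in `y`. -/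
noncomputable def regularized (M : Matrix I J ℝ) (π θ : I → ℝ) (x : J → ℝ) (y : I → ℝ) : ℝ :=
  π ⬝ᵥ M *ᵥ x - y ⬝ᵥ θ + reg M x y

/-- The minimizer of `regularized M π θ · y` over the unit box. -/
noncomputable def boxStep (M : Matrix I J ℝ) (π y : I → ℝ) (j : J) : ℝ :=
  clip (-(π ᵥ* M) j / (2 * (y ᵥ* M.map abs) j))

/-- The minimizer of `regularized M π θ x` over the simplex. -/
noncomputable def simplexStep (M : Matrix I J ℝ) (θ : I → ℝ) (x : J → ℝ) : I → ℝ :=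
  softmax fun i => (θ i - (M.map abs *ᵥ (x * x)) i) / 120

theorem norm_boxStep_le (M : Matrix I J ℝ) (π y : I → ℝ) : ‖boxStep M π y‖ ≤ 1 :=
  (pi_norm_le_iff_of_nonneg zero_le_one).2 fun _ => abs_clip_le _

theorem boxStep_optimal (M : Matrix I J ℝ) (π : I → ℝ) {y : I → ℝ} (hy : ∀ i, 0 < y i)
    {x : J → ℝ} (hx : ‖x‖ ≤ 1) :
    0 ≤ π ⬝ᵥ M *ᵥ (x - boxStep M π y)
      + 2 * (y ⬝ᵥ M.map abs *ᵥ (boxStep M π y * (x - boxStep M π y))) := by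
  have weight_nonneg (j : J) : 0 ≤ (y ᵥ* M.map abs) j :=
    Finset.sum_nonneg fun i _ => mul_nonneg (hy i).le (abs_nonneg _)
  have gradient_eq_zero (j : J) (hj : (y ᵥ* M.map abs) j = 0) : (π ᵥ* M) j = 0 := by
    have term_eq_zero := (Finset.sum_eq_zero_iff_of_nonneg fun i _ =>
      mul_nonneg (hy i).le (abs_nonneg (M i j))).1 hj
    refine Finset.sum_eq_zero fun i hi => mul_eq_zero_of_right _ (abs_eq_zero.1 ?_)
    exact (mul_eq_zero.1 (term_eq_zero i hi)).resolve_left (hy i).ne'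
  have := Finset.sum_nonneg fun j (_ : j ∈ Finset.univ) =>
    clip_optimal (weight_nonneg j) (gradient_eq_zero j) ((norm_le_pi_norm x j).trans hx)
  rw [Matrix.dotProduct_mulVec, Matrix.dotProduct_mulVec, dotProduct, dotProduct,
    Finset.mul_sum, ← Finset.sum_add_distrib]
  refine this.trans_eq (Finset.sum_congr rfl fun j _ => ?_)
  simp only [Pi.sub_apply, Pi.mul_apply, boxStep]
  ring

theorem regularized_eq_simplexStep_add [Nonempty I] (M : Matrix I J ℝ) (π θ : I → ℝ) (x : J → ℝ)
    {y : I → ℝ} (hy : ∑ i, y i = 1) :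
    regularized M π θ x y = regularized M π θ x (simplexStep M θ x)
      + 120 * relEntropy y (simplexStep M θ x) := by
  set y₁ := simplexStep M θ x with hy₁
  set f : I → ℝ := fun i => (θ i - (M.map abs *ᵥ (x * x)) i) / 120 with hf
  have sum_mul_log (z : I → ℝ) (hz : ∑ i, z i = 1) :
      120 * ∑ i, z i * Real.log (y₁ i)
        = z ⬝ᵥ θ - z ⬝ᵥ M.map abs *ᵥ (x * x) - 120 * Real.log (∑ k, Real.exp (f k)) := by
    have term (i : I) : z i * Real.log (y₁ i)
        = (z i * θ i - z i * (M.map abs *ᵥ (x * x)) i) / 120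
          - z i * Real.log (∑ k, Real.exp (f k)) := by
      rw [hy₁, simplexStep, log_softmax, hf]; ring
    simp only [term, Finset.sum_sub_distrib, ← Finset.sum_div, ← Finset.sum_mul, hz, dotProduct]
    ring
  have at_y := sum_mul_log y hy
  have at_y₁ := sum_mul_log y₁ (softmax_mem_stdSimplex f).2
  simp only [regularized, reg, relEntropy, Finset.sum_sub_distrib]
  linarith

/-- The box step is taken against the previous strategy `y₀`, which costs the cross term. -/
theorem regularized_alternating_step_le [Nonempty I] (M : Matrix I J ℝ) (π θ : I → ℝ)
    {y₀ y : I → ℝ} {x : J → ℝ} (hy₀ : ∀ i, 0 < y₀ i) (hx : ‖x‖ ≤ 1) (hy : ∑ i, y i = 1) :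
    let x₁ := boxStep M π y₀
    let y₁ := simplexStep M θ x₁
    regularized M π θ x₁ y₁ + 120 * relEntropy y y₁
      + y ⬝ᵥ M.map abs *ᵥ ((x - x₁) * (x - x₁))
      + 2 * ((y - y₀) ⬝ᵥ M.map abs *ᵥ (x₁ * (x - x₁)))
      ≤ regularized M π θ x y := by
  intro x₁ y₁
  have optimal_x := boxStep_optimal M π hy₀ hx
  have optimal_y := regularized_eq_simplexStep_add M π θ x₁ hy
  have square : x * x = x₁ * x₁ + (x - x₁) * (x - x₁) + (x₁ * (x - x₁) + x₁ * (x - x₁)) := by ring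
  have expand : regularized M π θ x y = regularized M π θ x₁ y + π ⬝ᵥ M *ᵥ (x - x₁)
      + y ⬝ᵥ M.map abs *ᵥ ((x - x₁) * (x - x₁))
      + 2 * (y ⬝ᵥ M.map abs *ᵥ (x₁ * (x - x₁))) := by
    simp only [regularized, reg]
    rw [square]
    simp only [Matrix.mulVec_add, Matrix.mulVec_sub, dotProduct_add, dotProduct_sub]
    ring
  rw [expand, optimal_y, sub_dotProduct]
  linarith

theorem reg_le_one {M : Matrix I J ℝ} (hM : ‖M‖ ≤ 1) {x : J → ℝ} (hx : ‖x‖ ≤ 1) {y : I → ℝ}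
    (hy : y ∈ stdSimplex ℝ I) : reg M x y ≤ 1 := by
  have entropy_nonpos : ∑ i, y i * Real.log (y i) ≤ 0 := Finset.sum_nonpos fun i _ =>
    Real.mul_log_nonpos (hy.1 i) (hy.2 ▸ Finset.single_le_sum (fun k _ => hy.1 k)
      (Finset.mem_univ i))
  have := (le_abs_self _).trans <| (abs_dotProduct_le_norm hy (M.map abs *ᵥ (x * x))).trans <|
    (norm_map_abs_mulVec_le hM _).trans (norm_mul_self_le_one hx)
  unfold reg
  linarith

theorem neg_log_card_le_reg [Nonempty I] (M : Matrix I J ℝ) (x : J → ℝ) {y : I → ℝ}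
    (hy : y ∈ stdSimplex ℝ I) : -(120 * Real.log (Fintype.card I)) ≤ reg M x y := by
  have := neg_log_card_le_sum_mul_log hy
  have := dotProduct_map_abs_mulVec_mul_self_nonneg M hy.1 x
  unfold reg
  linarith

/-- The move of the strategies from `(x, y)` to `(x', y')`, measured in the geometry of `reg`. -/
noncomputable def variation (M : Matrix I J ℝ) (x : J → ℝ) (y : I → ℝ) (x' : J → ℝ) (y' : I → ℝ) :
    ℝ :=
  y' ⬝ᵥ M.map abs *ᵥ ((x' - x) * (x' - x)) / 8 + 12 * ∑ i, (y' i - y i) ^ 2 / y' i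

theorem variation_nonneg (M : Matrix I J ℝ) (x : J → ℝ) (y : I → ℝ) (x' : J → ℝ) {y' : I → ℝ}
    (hy : ∀ i, 0 < y' i) : 0 ≤ variation M x y x' y' := by
  have := dotProduct_map_abs_mulVec_mul_self_nonneg M (fun i => (hy i).le) (x' - x)
  have := Finset.sum_nonneg fun i (_ : i ∈ Finset.univ) =>
    div_nonneg (sq_nonneg (y' i - y i)) (hy i).le
  unfold variation
  positivity

theorem variation_zero_le {M : Matrix I J ℝ} (hM : ‖M‖ ≤ 1) {x' : J → ℝ} (hx' : ‖x'‖ ≤ 1)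
    {y y' : I → ℝ} (hy : ∀ i, 0 ≤ y i) (hy' : y' ∈ stdSimplex ℝ I) (hyy' : ∀ i, y i ≤ 2 * y' i) :
    variation M 0 y x' y' ≤ 13 := by
  have square_le := (le_abs_self _).trans <| (abs_dotProduct_le_norm hy' _).trans <|
    (norm_map_abs_mulVec_le hM _).trans (norm_mul_self_le_one hx')
  have weights_le : ∑ i, (y' i - y i) ^ 2 / y' i ≤ 1 := by
    rw [← hy'.2]
    refine Finset.sum_le_sum fun i _ => div_le_of_le_mul₀ (hy'.1 i) (hy'.1 i) ?_
    nlinarith [hy i, hy'.1 i, hyy' i]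
  rw [variation, sub_zero]
  linarith

theorem neg_mul_le_mul_of_abs_le {a b A B : ℝ} (ha : |a| ≤ A) (hb : |b| ≤ B) :
    -(A * B) ≤ a * b := by
  refine (abs_le.1 ?_).1
  rw [abs_mul]
  exact mul_le_mul ha hb (abs_nonneg _) ((abs_nonneg _).trans ha)

/-- One iteration converts the gain from strong convexity into the new variation, up to the change
of the bilinear coupling between consecutive steps, which telescopes. -/
theorem variation_le {M : Matrix I J ℝ} (hM : ‖M‖ ≤ 1)
    (x₀ : J → ℝ) {x₁ : J → ℝ} (x₂ : J → ℝ) (y₀ : I → ℝ) {y₁ y₂ : I → ℝ} (hx₁ : ‖x₁‖ ≤ 1)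
    (hy₁ : ∀ i, 0 < y₁ i) (hy₂ : ∀ i, 0 < y₂ i)
    (h₁₂ : ∀ i, y₁ i ≤ 2 * y₂ i) (h₂₁ : ∀ i, y₂ i ≤ 2 * y₁ i) (hs : ∑ i, y₁ i = ∑ i, y₂ i) :
    variation M x₁ y₁ x₂ y₂ ≤ variation M x₀ y₀ x₁ y₁
      + 120 * relEntropy y₂ y₁
      + y₂ ⬝ᵥ M.map abs *ᵥ ((x₂ - x₁) * (x₂ - x₁))
      + 2 * ((y₂ - y₀) ⬝ᵥ M.map abs *ᵥ (x₁ * (x₂ - x₁)))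
      + ((y₁ - y₀) ⬝ᵥ M *ᵥ (x₂ - x₁) - (y₂ - y₁) ⬝ᵥ M *ᵥ (x₁ - x₀)) := by
  have relEntropy_eq : relEntropy y₂ y₁
      = ∑ i, (y₂ i * Real.log (y₂ i) - y₂ i * Real.log (y₁ i) - y₂ i + y₁ i) := by
    simp only [relEntropy, Finset.sum_sub_distrib, Finset.sum_add_distrib, hs]; ring
  rw [relEntropy_eq]
  simp only [variation, dotProduct, Finset.mul_sum, Finset.sum_div, ← Finset.sum_add_distrib,
    ← Finset.sum_sub_distrib]
  refine Finset.sum_le_sum fun i _ => ?_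
  have row := row_variation_le (hy₁ i) (hy₂ i) (h₁₂ i) (h₂₁ i)
    (sq_map_abs_mulVec_abs_le hM (x₂ - x₁) i) (sq_map_abs_mulVec_abs_le hM (x₁ - x₀) i)
    (u := |y₂ i - y₁ i|) (v := |y₁ i - y₀ i|)
    (by rw [sq_abs]; exact sq_sub_div_le (hy₂ i) (hy₁ i) (h₁₂ i))
  rw [sq_abs, sq_abs] at row
  have cross : -((|y₂ i - y₁ i| + |y₁ i - y₀ i|) * (M.map abs *ᵥ |x₂ - x₁|) i)
      ≤ (y₂ i - y₀ i) * (M.map abs *ᵥ (x₁ * (x₂ - x₁))) i :=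
    neg_mul_le_mul_of_abs_le (abs_sub_le _ _ _) (abs_map_abs_mulVec_mul_le M hx₁ _ i)
  have coupling : -(|y₁ i - y₀ i| * (M.map abs *ᵥ |x₂ - x₁|) i)
      ≤ (y₁ i - y₀ i) * (M *ᵥ (x₂ - x₁)) i :=
    neg_mul_le_mul_of_abs_le le_rfl (abs_mulVec_le M _ i)
  have coupling₀ : -(|y₂ i - y₁ i| * (M.map abs *ᵥ |x₁ - x₀|) i)
      ≤ -(y₂ i - y₁ i) * (M *ᵥ (x₁ - x₀)) i :=
    neg_mul_le_mul_of_abs_le (abs_neg _).le (abs_mulVec_le M _ i)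
  simp only [Pi.sub_apply]
  linarith

end Game

section Play

variable {I J : Type*} [Fintype I] [Fintype J]

/-- The current pair of strategies and the sums of all strategies after the initial one. -/
structure Play (I J : Type*) where
  x : J → ℝ
  y : I → ℝ
  X : J → ℝ
  Y : I → ℝ

/-- One iteration of optimistic dual averaging: each player plays against the sum of the other's
strategies with the current one counted twice. -/
noncomputable def Play.next (M : Matrix I J ℝ) (d : I → ℝ) (t : ℕ) (s : Play I J) : Play I J :=
  let x' := boxStep M (s.Y + s.y) s.y
  let y' := simplexStep M (M *ᵥ (s.X + s.x) + ((t : ℝ) + 1) • d) x'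
  ⟨x', y', s.X + x', s.Y + y'⟩

/-- The state of the method after `t` iterations for the box-simplex game with the payoff
`⟨y, M x + d⟩`, in which the box player minimizes. -/
noncomputable def play (M : Matrix I J ℝ) (d : I → ℝ) : ℕ → Play I J
  | 0 => ⟨0, softmax 0, 0, 0⟩
  | t + 1 => (play M d t).next M d t

variable (M : Matrix I J ℝ) (d : I → ℝ)

theorem norm_play_x_le (t : ℕ) : ‖(play M d t).x‖ ≤ 1 := by
  cases t with
  | zero => simp [play]
  | succ t => exact norm_boxStep_le _ _ _

theorem play_X_succ (t : ℕ) : (play M d (t + 1)).X = (play M d t).X + (play M d (t + 1)).x := rfl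

theorem play_Y_succ (t : ℕ) : (play M d (t + 1)).Y = (play M d t).Y + (play M d (t + 1)).y := rfl

theorem norm_play_X_le (t : ℕ) : ‖(play M d t).X‖ ≤ t := by
  induction t with
  | zero => simp [play]
  | succ t ih =>
    rw [play_X_succ, Nat.cast_succ]
    exact (norm_add_le _ _).trans (add_le_add ih (norm_play_x_le M d _))

/-- The logits of the simplex player's strategy; the initial strategy is uniform. -/
noncomputable def playLogit (M : Matrix I J ℝ) (d : I → ℝ) : ℕ → I → ℝ
  | 0 => 0
  | t + 1 => fun i => ((M *ᵥ ((play M d t).X + (play M d t).x) + ((t : ℝ) + 1) • d) i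
      - (M.map abs *ᵥ ((play M d (t + 1)).x * (play M d (t + 1)).x)) i) / 120

theorem play_y_eq_softmax (t : ℕ) : (play M d t).y = softmax (playLogit M d t) := by
  cases t <;> rfl

section Nonempty

variable [Nonempty I]

theorem play_y_pos (t : ℕ) (i : I) : 0 < (play M d t).y i := by
  rw [play_y_eq_softmax]
  exact softmax_pos _ i

theorem play_y_mem_stdSimplex (t : ℕ) : (play M d t).y ∈ stdSimplex ℝ I := by
  rw [play_y_eq_softmax]
  exact softmax_mem_stdSimplex _

theorem play_Y_nonneg (t : ℕ) (i : I) : 0 ≤ (play M d t).Y i := by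
  induction t with
  | zero => exact le_rfl
  | succ t ih => exact add_nonneg ih (play_y_pos M d (t + 1) i).le

theorem sum_play_Y (t : ℕ) : ∑ i, (play M d t).Y i = t := by
  induction t with
  | zero => simp [play]
  | succ t ih =>
    simp only [play_Y_succ, Pi.add_apply, Finset.sum_add_distrib, ih,
      (play_y_mem_stdSimplex M d (t + 1)).2, Nat.cast_succ]

theorem regularized_play_le (t : ℕ) {u : I → ℝ} {v : J → ℝ} (hu : u ∈ stdSimplex ℝ I)
    (hv : ‖v‖ ≤ 1) :
    let s := play M d t
    let s' := play M d (t + 1)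
    let value := regularized M (s.Y + s.y) (M *ᵥ (s.X + s.x) + ((t : ℝ) + 1) • d)
    value s'.x s'.y + 120 * relEntropy u s'.y + u ⬝ᵥ M.map abs *ᵥ ((v - s'.x) * (v - s'.x))
      + 2 * ((u - s.y) ⬝ᵥ M.map abs *ᵥ (s'.x * (v - s'.x)))
      ≤ value v u :=
  regularized_alternating_step_le M _ _ (play_y_pos M d t) hv hu.2

end Nonempty

variable {M d}

theorem abs_playLogit_succ_sub_le (hM : ‖M‖ ≤ 1) (hd : ‖d‖ ≤ 2) (t : ℕ) (i : I) :
    |playLogit M d (t + 1) i - playLogit M d t i| ≤ 1 / 20 := by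
  have d_mem := abs_le.1 ((norm_le_pi_norm d i).trans hd)
  have payoff_mem (t : ℕ) := abs_le.1 <| (norm_le_pi_norm (M *ᵥ (play M d t).x) i).trans <|
    (norm_mulVec_le hM _).trans (norm_play_x_le M d t)
  have square_nonneg (t : ℕ) : 0 ≤ (M.map abs *ᵥ ((play M d t).x * (play M d t).x)) i :=
    mulVec_map_abs_nonneg M (fun _ => mul_self_nonneg _) i
  have square_le (t : ℕ) := map_abs_mulVec_mul_self_le_one hM (norm_play_x_le M d t) i
  rw [abs_le]
  cases t with
  | zero =>
    have := square_nonneg 1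
    have := square_le 1
    simp only [playLogit, play, add_zero, Matrix.mulVec_zero, Pi.add_apply, Pi.zero_apply,
      Pi.smul_apply, smul_eq_mul, Nat.cast_zero] at *
    constructor <;> linarith
  | succ t =>
    have := payoff_mem t
    have := payoff_mem (t + 1)
    have := square_nonneg (t + 1)
    have := square_nonneg (t + 2)
    have := square_le (t + 1)
    have := square_le (t + 2)
    simp only [playLogit, play_X_succ, Matrix.mulVec_add, Pi.add_apply, Pi.smul_apply, smul_eq_mul,
      Nat.cast_succ]
    constructor <;> linarith

variable [Nonempty I]

theorem play_y_succ_le_two_mul (hM : ‖M‖ ≤ 1) (hd : ‖d‖ ≤ 2) (t : ℕ) (i : I) :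
    (play M d (t + 1)).y i ≤ 2 * (play M d t).y i := by
  rw [play_y_eq_softmax, play_y_eq_softmax]
  exact softmax_le_two_mul (abs_playLogit_succ_sub_le hM hd t) i

theorem play_y_le_two_mul_succ (hM : ‖M‖ ≤ 1) (hd : ‖d‖ ≤ 2) (t : ℕ) (i : I) :
    (play M d t).y i ≤ 2 * (play M d (t + 1)).y i := by
  rw [play_y_eq_softmax, play_y_eq_softmax]
  refine softmax_le_two_mul (fun i => ?_) i
  rw [abs_sub_comm]
  exact abs_playLogit_succ_sub_le hM hd t i

/-- The value of the regularized problem, here before the optimistic double counting, serves as a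
potential; it decreases no faster than the simplex player collects the offsets. -/
theorem potential_ge (hM : ‖M‖ ≤ 1) (hd : ‖d‖ ≤ 2) (t : ℕ) :
    let s := play M d t
    let s' := play M d (t + 1)
    variation M s.x s.y s'.x s'.y - 13 - 120 * Real.log (Fintype.card I) - s.Y ⬝ᵥ d
      ≤ regularized M s.Y (M *ᵥ s.X + (t : ℝ) • d) s'.x s'.y := by
  induction t with
  | zero =>
    have reg_ge := neg_log_card_le_reg M (play M d 1).x (play_y_mem_stdSimplex M d 1)
    have variation_le : variation M 0 _ _ _ ≤ 13 := variation_zero_le hM (norm_play_x_le M d 1)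
      (fun i => (play_y_pos M d 0 i).le) (play_y_mem_stdSimplex M d 1)
      (play_y_le_two_mul_succ hM hd 0)
    simp only [regularized, zero_add, play, zero_dotProduct, Matrix.mulVec_zero, Nat.cast_zero,
      zero_smul, dotProduct_zero] at *
    linarith
  | succ t ih =>
    have step := regularized_play_le M d t (play_y_mem_stdSimplex M d (t + 2))
      (norm_play_x_le M d (t + 2))
    have progress := variation_le hM (play M d t).x (play M d (t + 2)).x (play M d t).y
      (norm_play_x_le M d (t + 1)) (play_y_pos M d (t + 1)) (play_y_pos M d (t + 2))
      (play_y_le_two_mul_succ hM hd (t + 1)) (play_y_succ_le_two_mul hM hd (t + 1))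
      ((play_y_mem_stdSimplex M d _).2.trans (play_y_mem_stdSimplex M d _).2.symm)
    simp only [play_X_succ, play_Y_succ, regularized, Nat.cast_succ, Matrix.mulVec_add,
      Matrix.mulVec_sub, dotProduct_add, add_dotProduct, sub_dotProduct, dotProduct_sub,
      dotProduct_smul, smul_eq_mul] at *
    linarith

theorem play_gap (hM : ‖M‖ ≤ 1) (hd : ‖d‖ ≤ 2) (T : ℕ) {u : I → ℝ} {v : J → ℝ}
    (hu : u ∈ stdSimplex ℝ I) (hv : ‖v‖ ≤ 1) :
    u ⬝ᵥ (M *ᵥ (play M d T).X + (T : ℝ) • d)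
      ≤ (play M d T).Y ⬝ᵥ (M *ᵥ v + d) + (30 + 120 * Real.log (Fintype.card I)) := by
  have step := regularized_play_le M d T hu hv
  have potential := potential_ge hM hd T
  have variation_nonneg := variation_nonneg M (play M d T).x (play M d T).y (play M d (T + 1)).x
    (play_y_pos M d (T + 1))
  have entropy_nonneg := relEntropy_nonneg hu (play_y_pos M d (T + 1))
    (play_y_mem_stdSimplex M d (T + 1)).2
  have square_nonneg :=
    dotProduct_map_abs_mulVec_mul_self_nonneg M hu.1 (v - (play M d (T + 1)).x)
  have reg_le := reg_le_one hM hv hu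
  have norm_x := norm_play_x_le M d T
  have norm_x' := norm_play_x_le M d (T + 1)
  have norm_sub : ‖v - (play M d (T + 1)).x‖ ≤ 2 := (norm_sub_le _ _).trans (by linarith)
  have norm_cross : ‖M.map abs *ᵥ ((play M d (T + 1)).x * (v - (play M d (T + 1)).x))‖ ≤ 2 :=
    (norm_map_abs_mulVec_le hM _).trans <| (norm_mul_le _ _).trans <|
      (mul_le_of_le_one_left (norm_nonneg _) norm_x').trans norm_sub
  have norm_payoff : ‖M *ᵥ (play M d T).x + d‖ ≤ 3 :=
    (norm_add_le _ _).trans (by linarith [norm_mulVec_le hM (play M d T).x])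
  have cross_u := abs_le.1 ((abs_dotProduct_le_norm hu _).trans norm_cross)
  have cross_y := abs_le.1
    ((abs_dotProduct_le_norm (play_y_mem_stdSimplex M d T) _).trans norm_cross)
  have bilinear := abs_le.1 <| (abs_dotProduct_le_norm (play_y_mem_stdSimplex M d T) _).trans <|
    (norm_mulVec_le hM _).trans norm_sub
  have payoff_u := abs_le.1 ((abs_dotProduct_le_norm hu _).trans norm_payoff)
  have payoff_y := abs_le.1
    ((abs_dotProduct_le_norm (play_y_mem_stdSimplex M d (T + 1)) _).trans norm_payoff)
  simp only [regularized, Matrix.mulVec_add, Matrix.mulVec_sub, dotProduct_add, add_dotProduct,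
    sub_dotProduct, dotProduct_sub, dotProduct_smul, smul_eq_mul] at *
  linarith

end Play

section Regression

variable {I J : Type*} [Fintype I] [Fintype J]

/-- Every row of `B` with both signs: `‖B x - b‖` is the maximum of the coordinates of
`signedRows B *ᵥ x` shifted by `∓ b`. -/
def signedRows (B : Matrix I J ℝ) : Matrix (I ⊕ I) J ℝ :=
  Matrix.fromRows B (-B)

/-- The signed right-hand sides `∓ b`, shifted so that the largest is `0` and truncated at `-2`:
if `‖B‖ ≤ 1`, rows with a smaller offset never attain the maximum over the unit box. -/
noncomputable def offsets (b : I → ℝ) : I ⊕ I → ℝ :=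
  Sum.elim (fun i => max (-b i - ‖b‖) (-2)) (fun i => max (b i - ‖b‖) (-2))

theorem norm_signedRows_le {B : Matrix I J ℝ} (hB : ‖B‖ ≤ 1) : ‖signedRows B‖ ≤ 1 := by
  have row_le (i : I ⊕ I) : ∑ j, ‖signedRows B i j‖₊ ≤ 1 := by
    rw [← NNReal.coe_le_coe, NNReal.coe_sum]
    cases i <;> simpa [signedRows] using (sum_abs_le_norm B _).trans hB
  rw [Matrix.linfty_opNorm_def]
  exact_mod_cast Finset.sup_le fun i _ => row_le i

theorem norm_offsets_le (b : I → ℝ) : ‖offsets b‖ ≤ 2 := by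
  refine (pi_norm_le_iff_of_nonneg zero_le_two).2 fun i => abs_le.2 ?_
  have b_mem (i : I) := abs_le.1 (norm_le_pi_norm b i)
  cases i with
  | inl i => exact ⟨le_max_right _ _, max_le (by linarith [(b_mem i).1]) (by norm_num)⟩
  | inr i => exact ⟨le_max_right _ _, max_le (by linarith [(b_mem i).2]) (by norm_num)⟩

theorem signedRows_mulVec_add_offsets_le {B : Matrix I J ℝ} (hB : ‖B‖ ≤ 1) (b : I → ℝ) {v : J → ℝ}
    (hv : ‖v‖ ≤ 1) (i : I ⊕ I) :
    (signedRows B *ᵥ v) i + offsets b i ≤ ‖B *ᵥ v - b‖ - ‖b‖ := by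
  have norm_payoff := (norm_mulVec_le hB v).trans hv
  have norm_rhs : ‖b‖ ≤ ‖B *ᵥ v - b‖ + 1 := by
    linarith [norm_sub_norm_le b (B *ᵥ v), norm_sub_rev b (B *ᵥ v)]
  have residual (i : I) := abs_le.1 (norm_le_pi_norm (B *ᵥ v - b) i)
  have payoff (i : I) := abs_le.1 ((norm_le_pi_norm (B *ᵥ v) i).trans norm_payoff)
  simp only [Pi.sub_apply] at residual
  cases i with
  | inl i =>
    simp only [signedRows, offsets, Matrix.fromRows_mulVec, Sum.elim_inl, ← max_add_add_left]
    exact max_le (by linarith [residual i]) (by linarith [payoff i])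
  | inr i =>
    simp only [signedRows, offsets, Matrix.fromRows_mulVec, Sum.elim_inr, Matrix.neg_mulVec,
      Pi.neg_apply, ← max_add_add_left]
    exact max_le (by linarith [residual i]) (by linarith [payoff i])

theorem norm_mulVec_sub_le_of_signedRows [Nonempty I] {B : Matrix I J ℝ} {b : I → ℝ} {x : J → ℝ}
    {c : ℝ} (h : ∀ i, (signedRows B *ᵥ x) i + offsets b i ≤ c - ‖b‖) : ‖B *ᵥ x - b‖ ≤ c := by
  refine (pi_norm_le_iff_of_nonempty _).2 fun i => abs_le.2 ?_
  have upper := h (Sum.inl i)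
  have lower := h (Sum.inr i)
  simp only [signedRows, offsets, Matrix.fromRows_mulVec, Sum.elim_inl, Sum.elim_inr,
    Matrix.neg_mulVec, Pi.neg_apply, ← max_add_add_left] at upper lower
  have upper_signed := (le_max_left _ _).trans upper
  have lower_signed := (le_max_left _ _).trans lower
  rw [Pi.sub_apply]
  constructor <;> linarith

/-- The right-hand side of the problem after the substitution `x = x₀ + r u`, divided by
`r ‖A‖`. -/
noncomputable def scaledRhs (A : Matrix I J ℝ) (b : I → ℝ) (r : ℝ) (x₀ : J → ℝ) : I → ℝ :=
  (r * ‖A‖)⁻¹ • (b - A *ᵥ x₀)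

/-- The game for the problem scaled to the unit box and to a matrix of norm `1`. -/
noncomputable def scaledPlay (A : Matrix I J ℝ) (b : I → ℝ) (r : ℝ) (x₀ : J → ℝ) :
    ℕ → Play (I ⊕ I) J :=
  play (signedRows (‖A‖⁻¹ • A)) (offsets (scaledRhs A b r x₀))

theorem norm_mulVec_add_smul_sub {A : Matrix I J ℝ} (hA : 0 < ‖A‖) (b : I → ℝ) {r : ℝ} (hr : 0 < r)
    (x₀ u : J → ℝ) :
    ‖A *ᵥ (x₀ + r • u) - b‖ = r * ‖A‖ * ‖(‖A‖⁻¹ • A) *ᵥ u - scaledRhs A b r x₀‖ := by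
  have hrA : 0 < r * ‖A‖ := mul_pos hr hA
  rw [← Real.norm_of_nonneg hrA.le, ← norm_smul]
  congr 1
  rw [scaledRhs, smul_sub, smul_inv_smul₀ hrA.ne', Matrix.smul_mulVec, smul_smul,
    mul_inv_cancel_right₀ hA.ne', Matrix.mulVec_add, Matrix.mulVec_smul]
  abel

variable [Nonempty I]

theorem norm_mulVec_average_sub_le {B : Matrix I J ℝ} (hB : ‖B‖ ≤ 1) (b : I → ℝ) {v : J → ℝ}
    (hv : ‖v‖ ≤ 1) {T : ℕ} (hT : 0 < T) :
    ‖B *ᵥ ((T : ℝ)⁻¹ • (play (signedRows B) (offsets b) T).X) - b‖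
      ≤ ‖B *ᵥ v - b‖ + (30 + 120 * Real.log (2 * Fintype.card I)) / T := by
  classical
  have hT' : (0 : ℝ) < T := by exact_mod_cast hT
  refine norm_mulVec_sub_le_of_signedRows fun i => ?_
  have gap := play_gap (norm_signedRows_le hB) (norm_offsets_le b) T
    (single_mem_stdSimplex ℝ i) hv
  rw [single_one_dotProduct, Pi.add_apply, Pi.smul_apply, smul_eq_mul,
    show (Fintype.card (I ⊕ I) : ℝ) = 2 * Fintype.card I by simp; ring] at gap
  have collected : (play (signedRows B) (offsets b) T).Y ⬝ᵥ (signedRows B *ᵥ v + offsets b)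
      ≤ T * (‖B *ᵥ v - b‖ - ‖b‖) := by
    rw [← sum_play_Y (signedRows B) (offsets b) T, Finset.sum_mul]
    exact Finset.sum_le_sum fun k _ => mul_le_mul_of_nonneg_left
      (signedRows_mulVec_add_offsets_le hB b hv k) (play_Y_nonneg _ _ T k)
  rw [Matrix.mulVec_smul, Pi.smul_apply, smul_eq_mul, ← mul_le_mul_iff_right₀ hT']
  calc T * ((T : ℝ)⁻¹ * (signedRows B *ᵥ (play (signedRows B) (offsets b) T).X) i + offsets b i)
      = (signedRows B *ᵥ (play (signedRows B) (offsets b) T).X) i + T * offsets b i := by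
        field_simp
    _ ≤ T * (‖B *ᵥ v - b‖ - ‖b‖) + (30 + 120 * Real.log (2 * Fintype.card I)) :=
        gap.trans (add_le_add_left collected _)
    _ = _ := by field_simp; ring

theorem isApproxMin_add_smul_average {A : Matrix I J ℝ} (hA : 0 < ‖A‖) (b : I → ℝ) {r ε : ℝ}
    (hr : 0 < r) (hε : 0 < ε) (x₀ : J → ℝ) {T : ℕ} (hT : 0 < T)
    (hTε : (30 + 120 * Real.log (2 * Fintype.card I)) * (r * ‖A‖) / ε ≤ T) :
    IsApproxMin (fun x => ‖A *ᵥ x - b‖) {x | ∀ j, |x j - x₀ j| ≤ r} ε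
      (x₀ + r • (T : ℝ)⁻¹ • (scaledPlay A b r x₀ T).X) := by
  have hT' : (0 : ℝ) < T := by exact_mod_cast hT
  have norm_scaled : ‖‖A‖⁻¹ • A‖ ≤ 1 := by
    let _ : NormedSpace ℝ (Matrix I J ℝ) := Matrix.linftyOpNormedSpace
    rw [norm_smul, norm_inv, norm_norm, inv_mul_cancel₀ hA.ne']
  refine ⟨fun j => ?_, fun y hy => ?_⟩
  · have := (norm_le_pi_norm _ j).trans (norm_play_X_le (signedRows (‖A‖⁻¹ • A))
      (offsets (scaledRhs A b r x₀)) T)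
    rw [Pi.add_apply, add_sub_cancel_left, Pi.smul_apply, Pi.smul_apply, smul_eq_mul, smul_eq_mul,
      abs_mul, abs_mul, abs_of_pos hr, abs_of_pos (inv_pos.2 hT')]
    exact mul_le_of_le_one_right hr.le ((inv_mul_le_one₀ hT').2 this)
  · obtain ⟨v, rfl⟩ : ∃ v, y = x₀ + r • v :=
      ⟨r⁻¹ • (y - x₀), by rw [smul_inv_smul₀ hr.ne', add_sub_cancel]⟩
    have norm_v : ‖v‖ ≤ 1 := (pi_norm_le_iff_of_nonneg zero_le_one).2 fun j => by
      have := hy j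
      rw [Pi.add_apply, add_sub_cancel_left, Pi.smul_apply, smul_eq_mul, abs_mul,
        abs_of_pos hr] at this
      exact le_of_mul_le_mul_left (this.trans_eq (mul_one r).symm) hr
    have gap := norm_mulVec_average_sub_le norm_scaled (scaledRhs A b r x₀) norm_v hT
    have error_le : r * ‖A‖ * ((30 + 120 * Real.log (2 * Fintype.card I)) / T) ≤ ε := by
      rw [div_le_iff₀ hε] at hTε
      rw [← mul_div_assoc, div_le_iff₀ hT']
      linarith
    simp only [norm_mulVec_add_smul_sub hA b hr]
    calc _ ≤ r * ‖A‖ * _ := mul_le_mul_of_nonneg_left gap (by positivity)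
      _ ≤ _ := by rw [mul_add]; gcongr

end Regression

/-! ### Programs with a time bound -/

theorem Exec.time_pos {p : Prog} {s s' : State} {T : ℕ} (h : Exec p s s' T) : 0 < T := by
  induction h <;> omega

/-- A Hoare triple for total correctness: started in `s`, the program `p` halts within time `T` in
a state satisfying `Q`. -/
def Run (p : Prog) (s : State) (T : ℕ) (Q : State → Prop) : Prop :=
  ∃ s' t, Exec p s s' t ∧ t ≤ T ∧ Q s'

namespace Run

variable {p q : Prog} {s : State} {T U V : ℕ} {Q R : State → Prop}

theorem mono (h : Run p s T R) (hTU : T ≤ U) (hRQ : ∀ s', R s' → Q s') : Run p s U Q :=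
  let ⟨s', t, exec, time_le, hR⟩ := h
  ⟨s', t, exec, time_le.trans hTU, hRQ s' hR⟩

theorem skip (h : Q s) : Run .skip s 1 Q :=
  ⟨_, _, .skip s, le_rfl, h⟩

theorem nset {a : ℕ} {e : NExp} (h : Q (s.nset a (e.eval s))) :
    Run (.nset a e) s (e.cost + 1) Q :=
  ⟨_, _, .nset s a e, le_rfl, h⟩

theorem rset {a : ℕ} {e : RExp} (h : Q (s.rset a (e.eval s))) :
    Run (.rset a e) s (e.cost + 1) Q :=
  ⟨_, _, .rset s a e, le_rfl, h⟩

theorem nput {a : ℕ} {i e : NExp} (h : Q (s.nput a (i.eval s) (e.eval s))) :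
    Run (.nput a i e) s (i.cost + e.cost + 1) Q :=
  ⟨_, _, .nput s a i e, le_rfl, h⟩

theorem rput {a : ℕ} {i : NExp} {e : RExp} (h : Q (s.rput a (i.eval s) (e.eval s))) :
    Run (.rput a i e) s (i.cost + e.cost + 1) Q :=
  ⟨_, _, .rput s a i e, le_rfl, h⟩

-- Since `q` takes positive time, its hypothesis forces `T < V`: the subtraction never truncates.
theorem seq (hp : Run p s T R) (hq : ∀ s', R s' → Run q s' (V - T) Q) :
    Run (.seq p q) s V Q := by
  obtain ⟨s', t, exec, time_le, hR⟩ := hp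
  obtain ⟨s'', u, exec', time_le', hQ⟩ := hq s' hR
  have := exec'.time_pos
  exact ⟨s'', t + u, exec.seq exec', by omega, hQ⟩

theorem ite {t : Test} (hp : t.Holds s → Run p s T Q) (hq : ¬ t.Holds s → Run q s T Q) :
    Run (.ite t p q) s (t.cost + T + 1) Q := by
  by_cases ht : t.Holds s
  · obtain ⟨s', u, exec, time_le, hQ⟩ := hp ht
    exact ⟨s', _, .ite_true ht exec, by omega, hQ⟩
  · obtain ⟨s', u, exec, time_le, hQ⟩ := hq ht
    exact ⟨s', _, .ite_false ht exec, by omega, hQ⟩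

theorem loop {t : Test} {c : ℕ} (P : ℕ → State → Prop) (N : ℕ)
    (test_iff : ∀ k s, k ≤ N → P k s → (t.Holds s ↔ k < N))
    (step : ∀ k s, k < N → P k s → Run p s c (P (k + 1))) {k : ℕ} (hk : k ≤ N) (start : P k s) :
    Run (.loop t p) s ((N - k) * (t.cost + c + 1) + (t.cost + 1)) (P N) := by
  induction remaining : N - k generalizing s k with
  | zero =>
    obtain rfl : k = N := by omega
    exact ⟨s, _, .loop_false (by simp [test_iff k s le_rfl start]), by omega, start⟩
  | succ d ih =>
    obtain ⟨s', u, exec, time_le, next⟩ := step k s (by omega) start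
    obtain ⟨s'', u', exec', time_le', hQ⟩ := ih (k := k + 1) (by omega) next (by omega)
    refine ⟨s'', _, .loop_true ((test_iff k s hk start).2 (by omega)) exec exec', ?_, hQ⟩
    rw [add_mul]
    omega

end Run

/-- `for v < b do p`, where `b` is a variable. -/
def Prog.forLoop (v b : ℕ) (p : Prog) : Prog :=
  .seq (.nset v (.lit 0)) (.loop (.nlt (.var v) (.var b))
    (.seq p (.nset v (.add (.var v) (.lit 1)))))

theorem Run.forLoop {v b N c : ℕ} {p : Prog} {s : State} (P : ℕ → State → Prop)
    (registers : ∀ k s, P k s → s.nvar v = k ∧ s.nvar b = N) (start : P 0 (s.nset v 0))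
    (step : ∀ k s, k < N → P k s →
      Run p s c fun s' => s'.nvar v = k ∧ P (k + 1) (s'.nset v (k + 1))) :
    Run (.forLoop v b p) s (N * (c + 8) + 6) (P N) := by
  refine (Run.nset (Q := (· = s.nset v 0)) rfl).seq ?_
  rintro _ rfl
  refine (Run.loop P N (c := c + 4) ?test ?body N.zero_le start).mono ?time fun _ => id
  case test =>
    intro k s _ hP
    obtain ⟨counter, bound⟩ := registers k s hP
    simp only [Test.Holds, NExp.eval, counter, bound]
  case body =>
    intro k s hk hP
    refine (step k s hk hP).seq fun s' ⟨counter, next⟩ => ?_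
    refine (Run.nset ?_).mono (by simp only [NExp.cost]; omega) fun _ => id
    simpa only [NExp.eval, counter] using next
  case time =>
    simp only [NExp.cost, Test.cost, Nat.sub_zero]
    exact Nat.le_sub_of_add_le (le_of_eq (by ring))

/-! ### Loops over arrays -/

namespace Reg

/- Variables and arrays, of natural numbers and of reals, are numbered separately, so that each of
the four lists starts at `0`; the first numbers are those of `initState` and `output`. -/

@[simp] abbrev rows := 0
@[simp] abbrev cols := 1
@[simp] abbrev entries := 2
@[simp] abbrev rounds := 3
@[simp] abbrev round := 4
@[simp] abbrev ctr := 5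
@[simp] abbrev column := 6
@[simp] abbrev entry := 7
@[simp] abbrev steps := 8

@[simp] abbrev radius := 0
@[simp] abbrev accuracy := 1
@[simp] abbrev norm := 2
@[simp] abbrev scale := 3
@[simp] abbrev rhsNorm := 4
@[simp] abbrev temp := 5

@[simp] abbrev colPtr := 0
@[simp] abbrev rowIdx := 1
@[simp] abbrev colIdx := 2

@[simp] abbrev value := 0
@[simp] abbrev rhs := 1
@[simp] abbrev start := 2
@[simp] abbrev result := 3
@[simp] abbrev coeff := 4
@[simp] abbrev absCoeff := 5
@[simp] abbrev rowSum := 6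
@[simp] abbrev scaledRhs := 7
@[simp] abbrev upperOffset := 8
@[simp] abbrev lowerOffset := 9
@[simp] abbrev x := 10
@[simp] abbrev X := 11
@[simp] abbrev yUpper := 12
@[simp] abbrev yLower := 13
@[simp] abbrev YDiff := 14
@[simp] abbrev gradient := 15
@[simp] abbrev weight := 16
@[simp] abbrev payoff := 17
@[simp] abbrev curvature := 18

end Reg

abbrev RExp.const (k : ℕ) : RExp := .ofNat (.lit k)

/-- The cell of an array at the loop counter. -/
abbrev RExp.cell (a : ℕ) : RExp := .get a (.var Reg.ctr)

/-- The row of the entry at the loop counter. -/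
abbrev NExp.row : NExp := .get Reg.rowIdx (.var Reg.ctr)

/-- The column of the entry at the loop counter. -/
abbrev NExp.col : NExp := .get Reg.colIdx (.var Reg.ctr)

/-- The effect of a loop which rewrites the array `a` and leaves the loop counter at `k`. -/
def State.write (s : State) (a : ℕ) (g : ℕ → ℝ) (k : ℕ) : State :=
  { s with nvar := Function.update s.nvar Reg.ctr k, rarr := Function.update s.rarr a g }

attribute [local simp] State.write State.nset State.rset State.rput NExp.eval RExp.eval

theorem Run.forLoop_cell {a b N c : ℕ} {p : Prog} {s : State} (bound : s.nvar b = N)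
    (hb : b ≠ Reg.ctr) (f : ℕ → ℝ)
    (body : ∀ k g, k < N → g k = s.rarr a k →
      Run p (s.write a g k) c (· = s.write a (Function.update g k (f k)) k)) :
    Run (.forLoop Reg.ctr b p) s (N * (c + 8) + 6)
      fun s' => ∃ g, s' = s.write a g N ∧ ∀ i < N, g i = f i := by
  refine (Run.forLoop (N := N) (fun k s' => ∃ g, s' = s.write a g k ∧
    (∀ i < k, g i = f i) ∧ ∀ i, k ≤ i → g i = s.rarr a i) ?registers ?start ?step).mono le_rfl ?_
  case registers =>
    rintro k _ ⟨g, rfl, -⟩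
    simp [hb, bound]
  case start => exact ⟨s.rarr a, by simp, by simp, fun _ _ => rfl⟩
  case step =>
    rintro k _ hk ⟨g, rfl, done, rest⟩
    refine (body k g hk (rest k le_rfl)).mono le_rfl ?_
    rintro _ rfl
    refine ⟨by simp, Function.update g k (f k), by simp, fun i hi => ?_, fun i hi => ?_⟩
    · rcases Nat.lt_succ_iff_lt_or_eq.1 hi with hi | rfl
      · rw [Function.update_of_ne hi.ne, done i hi]
      · rw [Function.update_self]
    · rw [Function.update_of_ne (by omega), rest i (by omega)]
  case _ =>
    rintro _ ⟨g, rfl, done, -⟩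
    exact ⟨g, rfl, done⟩

/-- `a[i] := e` for `i < b`. -/
def Prog.fill (a b : ℕ) (e : RExp) : Prog := .forLoop Reg.ctr b (.rput a (.var Reg.ctr) e)

theorem Run.fill {a b N : ℕ} {e : RExp} {s : State} (bound : s.nvar b = N) (hb : b ≠ Reg.ctr)
    (f : ℕ → ℝ) (eval_eq : ∀ k g, k < N → g k = s.rarr a k → e.eval (s.write a g k) = f k) :
    Run (.fill a b e) s (N * (e.cost + 10) + 6)
      fun s' => ∃ g, s' = s.write a g N ∧ ∀ i < N, g i = f i := by
  refine (Run.forLoop_cell (c := e.cost + 2) bound hb f fun k g hk hg => ?_).mono le_rfl fun _ => id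
  refine (Run.rput ?_).mono (by simp only [NExp.cost]; omega) fun _ => id
  rw [eval_eq k g hk hg]
  simp

/-- `a[i] := max e f` for `i < b`. -/
def Prog.fillMax (a b : ℕ) (e f : RExp) : Prog :=
  .forLoop Reg.ctr b (.ite (.rlt e f) (.rput a (.var Reg.ctr) f) (.rput a (.var Reg.ctr) e))

theorem Run.fillMax {a b N : ℕ} {e e' : RExp} {s : State} (bound : s.nvar b = N)
    (hb : b ≠ Reg.ctr) (f f' : ℕ → ℝ)
    (eval_eq : ∀ k g, k < N → g k = s.rarr a k →
      e.eval (s.write a g k) = f k ∧ e'.eval (s.write a g k) = f' k) :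
    Run (.fillMax a b e e') s (N * (2 * e.cost + 2 * e'.cost + 12) + 6)
      fun s' => ∃ g, s' = s.write a g N ∧ ∀ i < N, g i = max (f i) (f' i) := by
  refine (Run.forLoop_cell (c := 2 * e.cost + 2 * e'.cost + 4) bound hb (fun i => max (f i) (f' i))
    fun k g hk hg => ?_).mono le_rfl fun _ => id
  obtain ⟨eval_e, eval_e'⟩ := eval_eq k g hk hg
  refine (Run.ite (T := e.cost + e'.cost + 2) (fun ht => ?_) fun ht => ?_).mono
    (by simp only [Test.cost]; omega) fun _ => id
  · rw [Test.Holds, eval_e, eval_e'] at ht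
    refine (Run.rput ?_).mono (by simp only [NExp.cost]; omega) fun _ => id
    rw [eval_e', max_eq_right ht.le]
    simp
  · rw [Test.Holds, eval_e, eval_e', not_lt] at ht
    refine (Run.rput ?_).mono (by simp only [NExp.cost]; omega) fun _ => id
    rw [eval_e, max_eq_left ht]
    simp

/-- `a := 0`, and then `a[i] += e` for `k < c`. -/
def Prog.scatter (a b c : ℕ) (i : NExp) (e : RExp) : Prog :=
  .seq (.fill a b (.const 0)) (.forLoop Reg.ctr c (.rput a i (.add (.get a i) e)))

theorem Run.scatter {a b c L N : ℕ} {i : NExp} {e : RExp} {s : State} (cells : s.nvar b = L)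
    (hb : b ≠ Reg.ctr) (bound : s.nvar c = N) (hc : c ≠ Reg.ctr) (idx : ℕ → ℕ) (f : ℕ → ℝ)
    (idx_eq : ∀ k g, k < N → i.eval (s.write a g k) = idx k)
    (eval_eq : ∀ k g, k < N → e.eval (s.write a g k) = f k) :
    Run (.scatter a b c i e) s (12 * L + N * (2 * i.cost + e.cost + 11) + 12)
      fun s' => ∃ g, s' = s.write a g N ∧
        ∀ j < L, g j = ∑ k ∈ Finset.range N, if idx k = j then f k else 0 := by
  refine (Run.fill cells hb (fun _ => 0) fun _ _ _ _ => by simp).seq ?_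
  rintro _ ⟨z, rfl, zero⟩
  refine (Run.forLoop (N := N) (c := 2 * i.cost + e.cost + 3) (fun k s' => ∃ g, s' = s.write a g k ∧
    ∀ j < L, g j = ∑ k ∈ Finset.range k, if idx k = j then f k else 0)
    ?registers ?start ?step).mono
    (by simp only [RExp.cost, NExp.cost, add_assoc, Nat.reduceAdd]; omega) fun _ => id
  case registers =>
    rintro k _ ⟨g, rfl, -⟩
    simp [hc, bound]
  case start => exact ⟨z, by simp, by simpa using zero⟩
  case step =>
    rintro k _ hk ⟨g, rfl, done⟩
    refine (Run.rput ?_).mono (by simp only [RExp.cost]; omega) fun _ => id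
    have cell_eval : (RExp.get a i).eval (s.write a g k) = g (idx k) := by
      simp [← idx_eq k g hk]
    have sum_eval : (RExp.add (.get a i) e).eval (s.write a g k) = g (idx k) + f k := by
      rw [RExp.eval, cell_eval, eval_eq k g hk]
    rw [sum_eval, idx_eq k g hk]
    refine ⟨by simp, Function.update g (idx k) (g (idx k) + f k), by simp, fun j hj => ?_⟩
    rw [Finset.sum_range_succ, ← done j hj]
    rcases eq_or_ne j (idx k) with rfl | hne
    · simp
    · simp [hne, hne.symm]

theorem Run.forLoop_rvar {z b N c : ℕ} {p : Prog} {s : State} (bound : s.nvar b = N)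
    (hb : b ≠ Reg.ctr) (f : ℕ → ℝ)
    (body : ∀ k < N, Run p ((s.rset z (f k)).nset Reg.ctr k) c
      (· = (s.rset z (f (k + 1))).nset Reg.ctr k)) :
    Run (.forLoop Reg.ctr b p) (s.rset z (f 0)) (N * (c + 8) + 6)
      (· = (s.rset z (f N)).nset Reg.ctr N) := by
  refine Run.forLoop (fun k s' => s' = (s.rset z (f k)).nset Reg.ctr k) ?_ rfl ?_
  · rintro k _ rfl
    simp [hb, bound]
  · rintro k _ hk rfl
    refine (body k hk).mono le_rfl ?_
    rintro _ rfl
    simp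

/-- `z := ∑ e` over `k < b`. -/
def Prog.accumulate (z b : ℕ) (e : RExp) : Prog :=
  .seq (.rset z (.const 0)) (.forLoop Reg.ctr b (.rset z (.add (.var z) e)))

theorem Run.accumulate {z b N : ℕ} {e : RExp} {s : State} (bound : s.nvar b = N)
    (hb : b ≠ Reg.ctr) (f : ℕ → ℝ)
    (eval_eq : ∀ k v, k < N → e.eval ((s.rset z v).nset Reg.ctr k) = f k) :
    Run (.accumulate z b e) s (N * (e.cost + 11) + 9)
      (· = (s.rset z (∑ k ∈ Finset.range N, f k)).nset Reg.ctr N) := by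
  refine (Run.rset (Q := (· = s.rset z 0)) (by simp)).seq ?_
  rintro _ rfl
  refine (Run.forLoop_rvar (c := e.cost + 3) bound hb (fun k => ∑ i ∈ Finset.range k, f i)
    fun k hk => ?_).mono
    (by simp only [RExp.cost, NExp.cost, add_assoc, Nat.reduceAdd]; omega) fun _ => id
  refine (Run.rset ?_).mono (by simp only [RExp.cost]; omega) fun _ => id
  rw [RExp.eval, eval_eq k _ hk]
  simp [Finset.sum_range_succ]

/-- `z := max |a[k]|` over `k < b`. -/
def Prog.supNorm (z b a : ℕ) : Prog :=
  .seq (.rset z (.const 0)) (.forLoop Reg.ctr b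
    (.ite (.rlt (.var z) (.cell a)) (.rset z (.cell a))
      (.ite (.rlt (.var z) (.sub (.const 0) (.cell a)))
        (.rset z (.sub (.const 0) (.cell a))) .skip)))

theorem norm_fin_succ {k : ℕ} (v : ℕ → ℝ) :
    ‖fun i : Fin (k + 1) => v i‖ = max ‖fun i : Fin k => v i‖ |v k| := by
  refine le_antisymm ((pi_norm_le_iff_of_nonneg (by positivity)).2 fun i => ?_) (max_le ?_ ?_)
  · refine i.lastCases (le_max_right _ _) fun i => le_max_of_le_left ?_
    exact norm_le_pi_norm (fun i : Fin k => v i) i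
  · exact (pi_norm_le_iff_of_nonneg (norm_nonneg _)).2 fun i =>
      norm_le_pi_norm (fun i : Fin (k + 1) => v i) i.castSucc
  · simpa using norm_le_pi_norm (fun i : Fin (k + 1) => v i) (Fin.last k)

theorem Run.supNorm {z b a N : ℕ} {s : State} (bound : s.nvar b = N) (hb : b ≠ Reg.ctr) :
    Run (.supNorm z b a) s (N * 30 + 9)
      (· = (s.rset z ‖fun i : Fin N => s.rarr a i‖).nset Reg.ctr N) := by
  have norm_zero : ‖fun i : Fin 0 => s.rarr a i‖ = 0 := by simp [Pi.norm_def]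
  refine (Run.rset (Q := (· = s.rset z ‖fun i : Fin 0 => s.rarr a i‖)) (by simp [norm_zero])).seq ?_
  rintro _ rfl
  refine (Run.forLoop_rvar (c := 22) bound hb (fun k => ‖fun i : Fin k => s.rarr a i‖)
    fun k _ => ?_).mono (by simp only [RExp.cost, NExp.cost]; omega) fun _ => id
  simp only [norm_fin_succ]
  refine (Run.ite (T := 16) (fun below => ?_) fun above => ?_).mono
    (by simp [Test.cost, RExp.cost, NExp.cost]) fun _ => id
  · replace below : ‖fun i : Fin k => s.rarr a i‖ < s.rarr a k := by
      simpa [Test.Holds] using below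
    refine (Run.rset ?_).mono (by simp [RExp.cost, NExp.cost]) fun _ => id
    simp [abs_of_pos ((norm_nonneg _).trans_lt below), below.le]
  replace above : s.rarr a k ≤ ‖fun i : Fin k => s.rarr a i‖ := by
    simpa [Test.Holds] using above
  refine (Run.ite (T := 7) (fun below => ?_) fun above' => ?_).mono
    (by simp [Test.cost, RExp.cost, NExp.cost]) fun _ => id
  · replace below : ‖fun i : Fin k => s.rarr a i‖ < -s.rarr a k := by
      simpa [Test.Holds] using below
    refine (Run.rset ?_).mono (by simp [RExp.cost, NExp.cost]) fun _ => id
    simp [abs_of_neg (neg_pos.1 ((norm_nonneg _).trans_lt below)), below.le]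
  · replace above' : -s.rarr a k ≤ ‖fun i : Fin k => s.rarr a i‖ := by
      simpa [Test.Holds] using above'
    refine (Run.skip ?_).mono (by omega) fun _ => id
    simp [max_eq_left (abs_le'.2 ⟨above, above'⟩)]

/-! ### Sparse matrices in memory -/

section Sparse

variable {n m N : ℕ} {row col : ℕ → ℕ}

/-- `B` is the sum of the elementary matrices `val k • E (row k) (col k)` over `k < N`, in the form
in which the loops over the entries use it. -/
def IsCoordList (B : Matrix (Fin n) (Fin m) ℝ) (N : ℕ) (row col : ℕ → ℕ) (val : ℕ → ℝ) : Prop :=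
  ∀ g : ℕ → ℕ → ℝ, ∑ k ∈ Finset.range N, val k * g (row k) (col k)
    = ∑ j : Fin m, ∑ i : Fin n, B i j * g i j

namespace IsCoordList

variable {B : Matrix (Fin n) (Fin m) ℝ} {val val' : ℕ → ℝ}

theorem congr (h : IsCoordList B N row col val) (hval : ∀ k < N, val' k = val k) :
    IsCoordList B N row col val' := fun g =>
  (Finset.sum_congr rfl fun k hk => by rw [hval k (Finset.mem_range.1 hk)]).trans (h g)

theorem inv_smul (h : IsCoordList B N row col val) {c : ℝ} (hval : ∀ k < N, val' k = val k / c) :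
    IsCoordList (c⁻¹ • B) N row col val' := fun g => by
  rw [Finset.sum_congr rfl fun k hk => by rw [hval k (Finset.mem_range.1 hk), div_eq_inv_mul,
    mul_assoc], ← Finset.mul_sum, h g]
  simp only [Finset.mul_sum, Matrix.smul_apply, smul_eq_mul, mul_assoc]

theorem sum_col (h : IsCoordList B N row col val) (u : ℕ → ℝ) (j : Fin m) :
    (∑ k ∈ Finset.range N, if col k = j then val k * u (row k) else 0)
      = ((fun i : Fin n => u i) ᵥ* B) j := by
  have := h fun i j' => if j' = j then u i else 0
  simpa [Matrix.vecMul, dotProduct, Fin.val_inj, mul_comm, Finset.sum_ite_irrel] using this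

theorem sum_row (h : IsCoordList B N row col val) (u : ℕ → ℝ) (i : Fin n) :
    (∑ k ∈ Finset.range N, if row k = i then val k * u (col k) else 0)
      = (B *ᵥ fun j : Fin m => u j) i := by
  have := h fun i' j => if i' = i then u j else 0
  simpa [Matrix.mulVec, dotProduct, Fin.val_inj] using this

end IsCoordList

namespace CSC

variable {A : Matrix (Fin n) (Fin m) ℝ}

theorem colPtr_mono (D : CSC A) {j j' : ℕ} (h : j ≤ j') (h' : j' ≤ m) :
    D.colPtr j ≤ D.colPtr j' := by
  induction j', h using Nat.le_induction with
  | base => rfl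
  | succ k _ ih => exact (ih (by omega)).trans (D.colPtr_le ⟨k, by omega⟩)

theorem column_unique (D : CSC A) {j j' k : ℕ} (hj : j < m) (hj' : j' < m)
    (ge : D.colPtr j ≤ k) (lt : k < D.colPtr (j + 1)) (ge' : D.colPtr j' ≤ k)
    (lt' : k < D.colPtr (j' + 1)) : j = j' := by
  rcases lt_trichotomy j j' with h | h | h
  · exact absurd (lt.trans_le ((D.colPtr_mono h hj'.le).trans ge')) (lt_irrefl k)
  · exact h
  · exact absurd (lt'.trans_le ((D.colPtr_mono h hj.le).trans ge)) (lt_irrefl k)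

theorem sum_range_colPtr {M : Type*} [AddCommMonoid M] (D : CSC A) (f : ℕ → M) :
    ∑ k ∈ Finset.range (D.colPtr m), f k
      = ∑ j : Fin m, ∑ k ∈ Finset.Ico (D.colPtr j) (D.colPtr (j + 1)), f k := by
  have partial_sum (l : ℕ) (hl : l ≤ m) : ∑ k ∈ Finset.range (D.colPtr l), f k
      = ∑ j ∈ Finset.range l, ∑ k ∈ Finset.Ico (D.colPtr j) (D.colPtr (j + 1)), f k := by
    induction l with
    | zero => simp [D.colPtr_zero]
    | succ l ih =>
      rw [Finset.sum_range_succ, ← ih (by omega), Finset.range_eq_Ico, Finset.range_eq_Ico,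
        Finset.sum_Ico_consecutive _ (Nat.zero_le _) (D.colPtr_le ⟨l, hl⟩)]
  rw [partial_sum m le_rfl, Finset.sum_range]

theorem sum_column {M : Type*} [AddCommMonoid M] (D : CSC A) (j : Fin m) (g : ℕ → ℝ → M)
    (hg : ∀ i, g i 0 = 0) :
    ∑ k ∈ Finset.Ico (D.colPtr j) (D.colPtr (j + 1)), g (D.rowIdx k) (D.val k)
      = ∑ i : Fin n, g i (A i j) := by
  classical
  have position (k) (hk : k ∈ Finset.Ico (D.colPtr j) (D.colPtr (j + 1))) :=
    D.sound j k (Finset.mem_Ico.1 hk).1 (Finset.mem_Ico.1 hk).2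
  choose row row_eq val_eq ne_zero using position
  rw [← Finset.sum_filter_of_ne (p := fun i => A i j ≠ 0) fun i _ h h0 => h (by rw [h0, hg])]
  refine Finset.sum_bij row (fun k hk => by simpa using ne_zero k hk) (fun k hk k' hk' h => ?_)
    (fun i hi => ?_) fun k hk => by rw [row_eq k hk, val_eq k hk]
  · obtain ⟨l, -, unique⟩ := D.complete j (row k hk) (ne_zero k hk)
    have bounds := Finset.mem_Ico.1 hk
    have bounds' := Finset.mem_Ico.1 hk'
    rw [unique k ⟨bounds.1, bounds.2, row_eq k hk⟩,
      unique k' ⟨bounds'.1, bounds'.2, h ▸ row_eq k' hk'⟩]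
  · obtain ⟨k, ⟨ge, lt, row_k⟩, -⟩ := D.complete j i (by simpa using hi)
    have hk := Finset.mem_Ico.2 ⟨ge, lt⟩
    exact ⟨k, hk, Fin.ext ((row_eq k hk).symm.trans row_k)⟩

theorem colPtr_eq_nnz (D : CSC A) : D.colPtr m = nnz A := by
  classical
  calc D.colPtr m = ∑ k ∈ Finset.range (D.colPtr m), 1 := by simp
    _ = ∑ j : Fin m, ∑ k ∈ Finset.Ico (D.colPtr j) (D.colPtr (j + 1)),
          if D.val k = 0 then 0 else 1 := by
        rw [D.sum_range_colPtr]
        refine Finset.sum_congr rfl fun j _ => Finset.sum_congr rfl fun k hk => ?_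
        have ⟨ge, lt⟩ := Finset.mem_Ico.1 hk
        obtain ⟨i, -, val_eq, ne_zero⟩ := D.sound j k ge lt
        rw [if_neg (val_eq ▸ ne_zero)]
    _ = ∑ j : Fin m, ∑ i : Fin n, if A i j = 0 then 0 else 1 :=
        Finset.sum_congr rfl fun j _ =>
          D.sum_column j (fun _ v => if v = 0 then 0 else 1) fun _ => if_pos rfl
    _ = nnz A := by
        refine Finset.sum_congr rfl fun j _ => ?_
        rw [colNnz, Set.ncard_eq_toFinset_card', Finset.card_eq_sum_ones, Set.toFinset_ofPred,
          Finset.sum_filter]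
        exact Finset.sum_congr rfl fun i _ => (ite_not ..).symm

/-- `col k` is the column of the entry at position `k`. -/
def IsColIdx (D : CSC A) (col : ℕ → ℕ) : Prop :=
  ∀ (j : Fin m) (k : ℕ), D.colPtr j ≤ k → k < D.colPtr (j + 1) → col k = j

theorem isCoordList_map (D : CSC A) (hcol : D.IsColIdx col) {f : ℝ → ℝ} (hf : f 0 = 0) :
    IsCoordList (A.map f) (nnz A) D.rowIdx col (fun k => f (D.val k)) := fun g => by
  rw [← D.colPtr_eq_nnz, D.sum_range_colPtr]
  refine Finset.sum_congr rfl fun j _ => ?_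
  refine .trans (Finset.sum_congr rfl fun k hk => ?_) (D.sum_column j (fun i v => f v * g i j)
    fun i => by rw [hf, zero_mul])
  rw [hcol j k (Finset.mem_Ico.1 hk).1 (Finset.mem_Ico.1 hk).2]

end CSC

end Sparse

/-! ### Reading the input -/

section Input

variable {n m : ℕ} {A : Matrix (Fin n) (Fin m) ℝ}

/-- The input is in memory. -/
structure Input (D : CSC A) (b : Fin n → ℝ) (r ε : ℝ) (x₀ : Fin m → ℝ) (s : State) : Prop where
  rows : s.nvar Reg.rows = n
  cols : s.nvar Reg.cols = m
  radius : s.rvar Reg.radius = r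
  accuracy : s.rvar Reg.accuracy = ε
  colPtr : s.narr Reg.colPtr = D.colPtr
  rowIdx : s.narr Reg.rowIdx = D.rowIdx
  value : s.rarr Reg.value = D.val
  rhs : ∀ i : Fin n, s.rarr Reg.rhs i = b i
  start : ∀ j : Fin m, s.rarr Reg.start j = x₀ j

variable {D : CSC A} {b : Fin n → ℝ} {r ε : ℝ} {x₀ : Fin m → ℝ}

theorem input_initState (ω : ℕ → unitInterval) : Input D b r ε x₀ (initState D b r ε x₀ ω) where
  rows := rfl
  cols := rfl
  radius := rfl
  accuracy := rfl
  colPtr := rfl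
  rowIdx := rfl
  value := rfl
  rhs i := dif_pos i.2
  start j := dif_pos j.2

/-- The sparse matrix is in memory as a list of entries with their columns. -/
structure Indexed (D : CSC A) (b : Fin n → ℝ) (r ε : ℝ) (x₀ : Fin m → ℝ) (s : State) : Prop
    extends Input D b r ε x₀ s where
  entries : s.nvar Reg.entries = nnz A
  colIdx : D.IsColIdx (s.narr Reg.colIdx)

/-- Either records the column of the current entry or moves on to the next column. -/
def Prog.advance : Prog :=
  .ite (.nlt (.var Reg.entry) (.get Reg.colPtr (.add (.var Reg.column) (.lit 1))))
    (.seq (.nput Reg.colIdx (.var Reg.entry) (.var Reg.column))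
      (.nset Reg.entry (.add (.var Reg.entry) (.lit 1))))
    (.nset Reg.column (.add (.var Reg.column) (.lit 1)))

/-- Recovers the column of every entry in one pass over the entries and the columns. -/
def Prog.findCols : Prog :=
  .seq (.nset Reg.entries (.get Reg.colPtr (.var Reg.cols))) <|
  .seq (.nset Reg.steps (.add (.var Reg.cols) (.var Reg.entries))) <|
  .seq (.nset Reg.column (.lit 0)) <| .seq (.nset Reg.entry (.lit 0)) <|
  .forLoop Reg.ctr Reg.steps .advance

/-- Invariant of `Prog.findCols`: after `t` steps, the entries before the current one have been
given their columns. -/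
structure Scanned (D : CSC A) (t : ℕ) (s : State) : Prop where
  column_add_entry : s.nvar Reg.column + s.nvar Reg.entry = t
  column_le : s.nvar Reg.column ≤ m
  colPtr_le : D.colPtr (s.nvar Reg.column) ≤ s.nvar Reg.entry
  entry_le : s.nvar Reg.entry ≤ nnz A
  colIdx : ∀ (j : Fin m) (k : ℕ), k < s.nvar Reg.entry → D.colPtr j ≤ k → k < D.colPtr (j + 1) →
    s.narr Reg.colIdx k = j

theorem Run.advance {t : ℕ} {s : State} (input : Input D b r ε x₀ s) (scanned : Scanned D t s)
    (ht : t < m + nnz A) :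
    Run .advance s 15 fun s' => (s'.nvar Reg.ctr = s.nvar Reg.ctr ∧
      s'.nvar Reg.steps = s.nvar Reg.steps ∧ s'.nvar Reg.entries = s.nvar Reg.entries) ∧
      Input D b r ε x₀ s' ∧ Scanned D (t + 1) s' := by
  obtain ⟨column_add_entry, column_le, colPtr_le, entry_le, colIdx⟩ := scanned
  have column_lt : s.nvar Reg.column < m := by
    refine lt_of_le_of_ne column_le fun h => ?_
    rw [h, D.colPtr_eq_nnz] at colPtr_le
    omega
  have next_le := D.colPtr_mono (j := s.nvar Reg.column + 1) column_lt le_rfl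
  rw [D.colPtr_eq_nnz] at next_le
  refine (Run.ite (T := 8) (fun inside => ?_) fun outside => ?_).mono
    (by simp [Test.cost, NExp.cost]) fun _ => id
  · replace inside : s.nvar Reg.entry < D.colPtr (s.nvar Reg.column + 1) := by
      simpa [Test.Holds, input.colPtr] using inside
    refine (Run.nput (Q := (· = _)) rfl).seq ?_
    rintro _ rfl
    refine (Run.nset ?_).mono (by simp [NExp.cost]) fun _ => id
    refine ⟨⟨rfl, rfl, rfl⟩, {input with}, congrArg Nat.succ column_add_entry, column_le,
      colPtr_le.trans (Nat.le_succ _), inside.trans_le next_le, fun j k hk ge lt => ?_⟩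
    rcases (Nat.le_of_lt_succ hk).lt_or_eq with hk | rfl
    · exact (Function.update_of_ne hk.ne _ _).trans (colIdx j k hk ge lt)
    · exact (Function.update_self ..).trans
        (D.column_unique column_lt j.2 colPtr_le inside ge lt)
  · replace outside : D.colPtr (s.nvar Reg.column + 1) ≤ s.nvar Reg.entry := by
      simpa [Test.Holds, input.colPtr] using outside
    refine (Run.nset ?_).mono (by simp [NExp.cost]) fun _ => id
    exact ⟨⟨rfl, rfl, rfl⟩, {input with},
      (Nat.add_right_comm _ 1 _).trans (congrArg Nat.succ column_add_entry), column_lt, outside,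
      entry_le, colIdx⟩

theorem Run.findCols {s : State} (input : Input D b r ε x₀ s) :
    Run .findCols s (30 * (m + nnz A + 1)) (Indexed D b r ε x₀) := by
  refine (Run.nset (Q := (· = s.nset Reg.entries (nnz A))) ?_).seq ?_
  · simp [input.cols, input.colPtr, D.colPtr_eq_nnz]
  rintro _ rfl
  refine (Run.nset (Q := (· = (s.nset Reg.entries (nnz A)).nset Reg.steps (m + nnz A))) ?_).seq ?_
  · simp [input.cols]
  rintro _ rfl
  refine (Run.nset (Q := (· = _)) rfl).seq ?_
  rintro _ rfl
  refine (Run.nset (Q := (· = _)) rfl).seq ?_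
  rintro _ rfl
  refine (Run.forLoop (N := m + nnz A) (c := 15) (fun t s' => (s'.nvar Reg.ctr = t ∧
    s'.nvar Reg.steps = m + nnz A ∧ s'.nvar Reg.entries = nnz A) ∧ Input D b r ε x₀ s' ∧
    Scanned D t s') ?registers ?start ?step).mono (by simp only [NExp.cost]; omega) ?post
  case registers =>
    rintro t s' ⟨⟨counter, bound, -⟩, -⟩
    exact ⟨counter, bound⟩
  case start =>
    refine ⟨⟨rfl, rfl, rfl⟩, {input with}, rfl, Nat.zero_le _, D.colPtr_zero.le, Nat.zero_le _, ?_⟩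
    exact fun _ _ hk => absurd hk (Nat.not_lt_zero _)
  case step =>
    rintro t s' ht ⟨⟨counter, bound, entries⟩, input', scanned⟩
    refine (Run.advance input' scanned ht).mono le_rfl ?_
    rintro s'' ⟨⟨counter', bound', entries'⟩, input'', scanned'⟩
    exact ⟨counter'.trans counter, ⟨rfl, bound'.trans bound, entries'.trans entries⟩,
      {input'' with}, {scanned' with}⟩
  case post =>
    rintro s' ⟨⟨-, -, entries⟩, input', scanned⟩
    refine { input' with
      entries := entries, colIdx := fun j k ge lt => scanned.colIdx j k ?_ ge lt }
    have := D.colPtr_mono (j := j + 1) j.2 le_rfl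
    rw [D.colPtr_eq_nnz] at this
    have := scanned.column_add_entry
    have := scanned.column_le
    omega

end Input

/-! ### One round of the game -/

section Round

variable {n m : ℕ}

/-- The matrix `B` is in memory as a list of `N` entries. -/
structure Coords (B : Matrix (Fin n) (Fin m) ℝ) (N : ℕ) (s : State) : Prop where
  rows : s.nvar Reg.rows = n
  cols : s.nvar Reg.cols = m
  entries : s.nvar Reg.entries = N
  coeff : IsCoordList B N (s.narr Reg.rowIdx) (s.narr Reg.colIdx) (s.rarr Reg.coeff)
  absCoeff : IsCoordList (B.map abs) N (s.narr Reg.rowIdx) (s.narr Reg.colIdx)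
    (s.rarr Reg.absCoeff)

/-- The game with payoff matrix `signedRows B` and offsets `d` is in memory. -/
structure Ready (B : Matrix (Fin n) (Fin m) ℝ) (d : Fin n ⊕ Fin n → ℝ) (N : ℕ) (s : State) : Prop
    extends Coords B N s where
  upperOffset : ∀ i : Fin n, s.rarr Reg.upperOffset i = d (.inl i)
  lowerOffset : ∀ i : Fin n, s.rarr Reg.lowerOffset i = d (.inr i)

/-- The state of the game is in memory; of the sums `Y`, only the differences of the two signs of
each row are kept. -/
structure Stores (P : Play (Fin n ⊕ Fin n) (Fin m)) (s : State) : Prop where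
  x : ∀ j : Fin m, s.rarr Reg.x j = P.x j
  X : ∀ j : Fin m, s.rarr Reg.X j = P.X j
  yUpper : ∀ i : Fin n, s.rarr Reg.yUpper i = P.y (.inl i)
  yLower : ∀ i : Fin n, s.rarr Reg.yLower i = P.y (.inr i)
  YDiff : ∀ i : Fin n, s.rarr Reg.YDiff i = P.Y (.inl i) - P.Y (.inr i)

/-- The memory which a round of the game only reads is the same in both states. -/
structure SameData (s s' : State) : Prop where
  nvar : ∀ a ≠ Reg.ctr, s'.nvar a = s.nvar a
  rvar : ∀ a ≠ Reg.temp, s'.rvar a = s.rvar a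
  narr : s'.narr = s.narr
  rarr : ∀ a < Reg.x, s'.rarr a = s.rarr a

theorem SameData.trans {s s' s'' : State} (h : SameData s s') (h' : SameData s' s'') :
    SameData s s'' where
  nvar a ha := (h'.nvar a ha).trans (h.nvar a ha)
  rvar a ha := (h'.rvar a ha).trans (h.rvar a ha)
  narr := h'.narr.trans h.narr
  rarr a ha := (h'.rarr a ha).trans (h.rarr a ha)

theorem sameData_write (s : State) {a : ℕ} (ha : Reg.x ≤ a) (g : ℕ → ℝ) (k : ℕ) :
    SameData s (s.write a g k) where
  nvar _ hb := Function.update_of_ne hb _ _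
  rvar _ _ := rfl
  narr := rfl
  rarr _ hb := Function.update_of_ne (hb.trans_le ha).ne _ _

variable {B : Matrix (Fin n) (Fin m) ℝ} {d : Fin n ⊕ Fin n → ℝ} {N : ℕ}
  {P : Play (Fin n ⊕ Fin n) (Fin m)} {s s' : State}

theorem Ready.of_sameData (h : Ready B d N s) (hs : SameData s s') : Ready B d N s' where
  rows := (hs.nvar _ (by decide)).trans h.rows
  cols := (hs.nvar _ (by decide)).trans h.cols
  entries := (hs.nvar _ (by decide)).trans h.entries
  coeff := by rw [hs.narr, hs.rarr _ (by decide)]; exact h.coeff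
  absCoeff := by rw [hs.narr, hs.rarr _ (by decide)]; exact h.absCoeff
  upperOffset := by rw [hs.rarr _ (by decide)]; exact h.upperOffset
  lowerOffset := by rw [hs.rarr _ (by decide)]; exact h.lowerOffset

/-- The products of the strategies and their sums with the matrix, computed by loops over the
entries. -/
def Prog.gather : Prog :=
  .seq (.scatter Reg.gradient Reg.cols Reg.entries .col (.mul (.cell Reg.coeff)
    (.add (.get Reg.YDiff .row) (.sub (.get Reg.yUpper .row) (.get Reg.yLower .row))))) <|
  .seq (.scatter Reg.weight Reg.cols Reg.entries .col (.mul (.cell Reg.absCoeff)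
    (.add (.get Reg.yUpper .row) (.get Reg.yLower .row)))) <|
  .scatter Reg.payoff Reg.rows Reg.entries .row (.mul (.cell Reg.coeff)
    (.add (.get Reg.X .col) (.get Reg.x .col)))

theorem Run.gather (h : Ready B d N s) (hP : Stores P s) :
    Run .gather s (100 * (n + m + N + 1)) fun s' => SameData s s' ∧ Stores P s' ∧
      (∀ j : Fin m, s'.rarr Reg.gradient j = ((fun i => (P.Y + P.y) (.inl i) -
        (P.Y + P.y) (.inr i)) ᵥ* B) j) ∧
      (∀ j : Fin m, s'.rarr Reg.weight j =
        ((fun i => P.y (.inl i) + P.y (.inr i)) ᵥ* B.map abs) j) ∧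
      ∀ i : Fin n, s'.rarr Reg.payoff i = (B *ᵥ (P.X + P.x)) i := by
  refine (Run.scatter h.cols (by decide) h.entries (by decide) (s.narr Reg.colIdx)
    (fun k => s.rarr Reg.coeff k * (s.rarr Reg.YDiff (s.narr Reg.rowIdx k) +
      (s.rarr Reg.yUpper (s.narr Reg.rowIdx k) - s.rarr Reg.yLower (s.narr Reg.rowIdx k))))
    (fun k g _ => by simp) fun k g _ => by simp).seq ?_
  rintro _ ⟨gradient, rfl, gradient_eq⟩
  refine (Run.scatter (by exact h.cols) (by decide) (by exact h.entries) (by decide)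
    (s.narr Reg.colIdx) (fun k => s.rarr Reg.absCoeff k *
      (s.rarr Reg.yUpper (s.narr Reg.rowIdx k) + s.rarr Reg.yLower (s.narr Reg.rowIdx k)))
    (fun k g _ => by simp) fun k g _ => by simp).seq ?_
  rintro _ ⟨weight, rfl, weight_eq⟩
  refine (Run.scatter (by exact h.rows) (by decide) (by exact h.entries) (by decide)
    (s.narr Reg.rowIdx) (fun k => s.rarr Reg.coeff k *
      (s.rarr Reg.X (s.narr Reg.colIdx k) + s.rarr Reg.x (s.narr Reg.colIdx k)))
    (fun k g _ => by simp) fun k g _ => by simp).mono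
    (by simp only [NExp.cost, RExp.cost]; omega) ?_
  rintro _ ⟨payoff, rfl, payoff_eq⟩
  refine ⟨((sameData_write _ (by decide) _ _).trans (sameData_write _ (by decide) _ _)).trans
    (sameData_write _ (by decide) _ _), {hP with}, fun j => ?_, fun j => ?_, fun i => ?_⟩
  · refine ((gradient_eq j j.2).trans (h.coeff.sum_col (fun i => s.rarr Reg.YDiff i +
      (s.rarr Reg.yUpper i - s.rarr Reg.yLower i)) j)).trans ?_
    simp only [hP.YDiff, hP.yUpper, hP.yLower, Pi.add_apply, add_sub_add_comm]
  · refine ((weight_eq j j.2).trans (h.absCoeff.sum_col (fun i => s.rarr Reg.yUpper i +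
      s.rarr Reg.yLower i) j)).trans ?_
    simp only [hP.yUpper, hP.yLower]
  · refine ((payoff_eq i i.2).trans (h.coeff.sum_row (fun j => s.rarr Reg.X j +
      s.rarr Reg.x j) i)).trans ?_
    simp only [hP.X, hP.x]
    rfl

/-- Replaces the strategy of the box player by `boxStep` and adds it to the sum. -/
def Prog.boxMove : Prog :=
  .seq (.fillMax Reg.x Reg.cols (.div (.cell Reg.gradient) (.mul (.const 2) (.cell Reg.weight)))
    (.sub (.const 0) (.const 1))) <|
  .seq (.fillMax Reg.x Reg.cols (.sub (.const 0) (.cell Reg.x)) (.sub (.const 0) (.const 1))) <|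
  .fill Reg.X Reg.cols (.add (.cell Reg.X) (.cell Reg.x))

theorem boxStep_signedRows (B : Matrix (Fin n) (Fin m) ℝ) (π y : Fin n ⊕ Fin n → ℝ) (j : Fin m) :
    boxStep (signedRows B) π y j =
      clip (-((fun i => π (.inl i) - π (.inr i)) ᵥ* B) j
        / (2 * ((fun i => y (.inl i) + y (.inr i)) ᵥ* B.map abs) j)) := by
  simp only [boxStep, signedRows, Matrix.vecMul, dotProduct, Fintype.sum_sum_type,
    Matrix.fromRows_apply_inl, Matrix.fromRows_apply_inr, Matrix.map_apply, Matrix.neg_apply,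
    abs_neg, mul_neg, ← Finset.sum_add_distrib, add_mul, sub_eq_add_neg, neg_mul]

theorem clip_neg (z : ℝ) : clip (-z) = max (-max z (-1)) (-1) := by
  rw [clip, ← min_neg_neg, neg_neg, max_comm]

theorem Run.boxMove (h : Ready B d N s) (hP : Stores P s) {π y : Fin n ⊕ Fin n → ℝ}
    (gradient_eq : ∀ j : Fin m, s.rarr Reg.gradient j =
      ((fun i => π (.inl i) - π (.inr i)) ᵥ* B) j)
    (weight_eq : ∀ j : Fin m, s.rarr Reg.weight j =
      ((fun i => y (.inl i) + y (.inr i)) ᵥ* B.map abs) j) :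
    Run .boxMove s (100 * (m + 1)) fun s' => SameData s s' ∧
      Stores ⟨boxStep (signedRows B) π y, P.y, P.X + boxStep (signedRows B) π y, P.Y⟩ s' ∧
      s'.rarr Reg.payoff = s.rarr Reg.payoff := by
  refine (Run.fillMax h.cols (by decide)
    (fun j => s.rarr Reg.gradient j / (2 * s.rarr Reg.weight j)) (fun _ => -1)
    fun k g _ _ => by simp).seq ?_
  rintro _ ⟨x, rfl, x_eq⟩
  refine (Run.fillMax (by exact h.cols) (by decide) (fun j => -x j) (fun _ => -1)
    fun k g _ hg => by simp_all).seq ?_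
  rintro _ ⟨x', rfl, x'_eq⟩
  refine (Run.fill (by exact h.cols) (by decide) (fun j => s.rarr Reg.X j + x' j)
    fun k g _ hg => by simp_all).mono (by simp only [NExp.cost, RExp.cost]; omega) ?_
  rintro _ ⟨X, rfl, X_eq⟩
  have x'_eq_boxStep (j : Fin m) : x' j = boxStep (signedRows B) π y j := by
    rw [boxStep_signedRows, neg_div, clip_neg, x'_eq j j.2, x_eq j j.2, gradient_eq, weight_eq]
  refine ⟨((sameData_write _ (by decide) _ _).trans (sameData_write _ (by decide) _ _)).trans
    (sameData_write _ (by decide) _ _), {hP with x := x'_eq_boxStep, X := fun j => ?_}, rfl⟩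
  refine (X_eq j j.2).trans ?_
  rw [hP.X, x'_eq_boxStep]
  rfl

/-- Stores the exponentials of the logits of `simplexStep` as the weights `y`. -/
def Prog.expWeights : Prog :=
  .seq (.scatter Reg.curvature Reg.rows Reg.entries .row
    (.mul (.cell Reg.absCoeff) (.mul (.get Reg.x .col) (.get Reg.x .col)))) <|
  .seq (.fill Reg.yUpper Reg.rows (.exp (.div (.sub (.add (.cell Reg.payoff)
    (.mul (.add (.ofNat (.var Reg.round)) (.const 1)) (.cell Reg.upperOffset)))
    (.cell Reg.curvature)) (.const 120)))) <|
  .fill Reg.yLower Reg.rows (.exp (.div (.sub (.add (.sub (.const 0) (.cell Reg.payoff))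
    (.mul (.add (.ofNat (.var Reg.round)) (.const 1)) (.cell Reg.lowerOffset)))
    (.cell Reg.curvature)) (.const 120)))

theorem Run.expWeights {t : ℕ} {π : Fin n → ℝ} (h : Ready B d N s) (hP : Stores P s)
    (round_eq : s.nvar Reg.round = t) (payoff_eq : ∀ i : Fin n, s.rarr Reg.payoff i = π i) :
    Run .expWeights s (100 * (n + N + 1)) fun s' => SameData s s' ∧
      Stores {P with y := fun i => Real.exp ((Sum.elim π (-π) i + ((t : ℝ) + 1) * d i -
        Sum.elim (B.map abs *ᵥ (P.x * P.x)) (B.map abs *ᵥ (P.x * P.x)) i) / 120)} s' := by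
  refine (Run.scatter h.rows (by decide) h.entries (by decide) (s.narr Reg.rowIdx)
    (fun k => s.rarr Reg.absCoeff k * (s.rarr Reg.x (s.narr Reg.colIdx k) *
      s.rarr Reg.x (s.narr Reg.colIdx k)))
    (fun k g _ => by simp) fun k g _ => by simp).seq ?_
  rintro _ ⟨curvature, rfl, curvature_eq⟩
  refine (Run.fill (by exact h.rows) (by decide) (fun i => Real.exp ((s.rarr Reg.payoff i +
    ((t : ℝ) + 1) * s.rarr Reg.upperOffset i - curvature i) / 120))
    fun k g _ _ => by simp [round_eq]).seq ?_
  rintro _ ⟨yUpper, rfl, yUpper_eq⟩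
  refine (Run.fill (by exact h.rows) (by decide) (fun i => Real.exp ((-s.rarr Reg.payoff i +
    ((t : ℝ) + 1) * s.rarr Reg.lowerOffset i - curvature i) / 120))
    fun k g _ _ => by simp [round_eq]).mono (by simp only [NExp.cost, RExp.cost]; omega) ?_
  rintro _ ⟨yLower, rfl, yLower_eq⟩
  have curvature_eq' (i : Fin n) : curvature i = (B.map abs *ᵥ (P.x * P.x)) i := by
    refine ((curvature_eq i i.2).trans (h.absCoeff.sum_row (fun j => s.rarr Reg.x j *
      s.rarr Reg.x j) i)).trans ?_
    simp only [hP.x]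
    rfl
  refine ⟨((sameData_write _ (by decide) _ _).trans (sameData_write _ (by decide) _ _)).trans
    (sameData_write _ (by decide) _ _),
    {hP with yUpper := fun i => (yUpper_eq i i.2).trans ?_,
             yLower := fun i => (yLower_eq i i.2).trans ?_}⟩
  · rw [payoff_eq, h.upperOffset, curvature_eq']
    rfl
  · rw [payoff_eq, h.lowerOffset, curvature_eq']
    rfl

/-- Divides the weights `y` by their sum, which completes `simplexStep`, and updates `YDiff`. -/
def Prog.normalize : Prog :=
  .seq (.accumulate Reg.temp Reg.rows (.add (.cell Reg.yUpper) (.cell Reg.yLower))) <|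
  .seq (.fill Reg.yUpper Reg.rows (.div (.cell Reg.yUpper) (.var Reg.temp))) <|
  .seq (.fill Reg.yLower Reg.rows (.div (.cell Reg.yLower) (.var Reg.temp))) <|
  .fill Reg.YDiff Reg.rows
    (.add (.cell Reg.YDiff) (.sub (.cell Reg.yUpper) (.cell Reg.yLower)))

theorem sameData_temp (s : State) (v : ℝ) (k : ℕ) :
    SameData s ((s.rset Reg.temp v).nset Reg.ctr k) where
  nvar _ hb := Function.update_of_ne hb _ _
  rvar _ hb := Function.update_of_ne hb _ _
  narr := rfl
  rarr _ _ := rfl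

theorem Run.normalize (h : Ready B d N s) (hP : Stores P s) {y : Fin n ⊕ Fin n → ℝ}
    (hy : ∀ i, y i = P.y i / ∑ i, P.y i) :
    Run .normalize s (100 * (n + 1)) fun s' =>
      SameData s s' ∧ Stores {P with y := y, Y := P.Y + y} s' := by
  refine (Run.accumulate h.rows (by decide) (fun i => s.rarr Reg.yUpper i + s.rarr Reg.yLower i)
    fun k v _ => by simp).seq ?_
  rintro _ rfl
  have sum_eq : ∑ i ∈ Finset.range n, (s.rarr Reg.yUpper i + s.rarr Reg.yLower i) = ∑ i, P.y i := by
    simp only [Finset.sum_range, hP.yUpper, hP.yLower, Finset.sum_add_distrib,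
      Fintype.sum_sum_type]
  rw [sum_eq]
  refine (Run.fill (by exact h.rows) (by decide) (fun i => s.rarr Reg.yUpper i / ∑ i, P.y i)
    fun k g _ hg => by simp_all).seq ?_
  rintro _ ⟨yUpper, rfl, yUpper_eq⟩
  refine (Run.fill (by exact h.rows) (by decide) (fun i => s.rarr Reg.yLower i / ∑ i, P.y i)
    fun k g _ hg => by simp_all).seq ?_
  rintro _ ⟨yLower, rfl, yLower_eq⟩
  refine (Run.fill (by exact h.rows) (by decide)
    (fun i => s.rarr Reg.YDiff i + (yUpper i - yLower i))
    fun k g _ hg => by simp_all).mono (by simp only [NExp.cost, RExp.cost]; omega) ?_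
  rintro _ ⟨YDiff, rfl, YDiff_eq⟩
  have yUpper_eq' (i : Fin n) : yUpper i = y (.inl i) := by
    rw [yUpper_eq i i.2, hP.yUpper, hy]
  have yLower_eq' (i : Fin n) : yLower i = y (.inr i) := by
    rw [yLower_eq i i.2, hP.yLower, hy]
  refine ⟨(((sameData_temp _ _ _).trans (sameData_write _ (by decide) _ _)).trans
    (sameData_write _ (by decide) _ _)).trans (sameData_write _ (by decide) _ _),
    {hP with yUpper := yUpper_eq', yLower := yLower_eq', YDiff := fun i => ?_}⟩
  refine (YDiff_eq i i.2).trans ?_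
  rw [hP.YDiff, yUpper_eq', yLower_eq']
  exact (add_sub_add_comm _ _ _ _).symm

/-- One round of the game, `Play.next`. -/
def Prog.iteration : Prog := .seq .gather (.seq .boxMove (.seq .expWeights .normalize))

theorem signedRows_mulVec (B : Matrix (Fin n) (Fin m) ℝ) (z : Fin m → ℝ) :
    signedRows B *ᵥ z = Sum.elim (B *ᵥ z) (-(B *ᵥ z)) := by
  rw [signedRows, Matrix.fromRows_mulVec, Matrix.neg_mulVec]

theorem map_abs_signedRows_mulVec (B : Matrix (Fin n) (Fin m) ℝ) (z : Fin m → ℝ) :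
    (signedRows B).map abs *ᵥ z = Sum.elim (B.map abs *ᵥ z) (B.map abs *ᵥ z) := by
  have map_abs : (signedRows B).map abs = Matrix.fromRows (B.map abs) (B.map abs) := by
    ext (i | i) j <;> simp [signedRows]
  rw [map_abs, Matrix.fromRows_mulVec]

theorem Run.iteration {t : ℕ} (h : Ready B d N s) (hP : Stores P s)
    (round_eq : s.nvar Reg.round = t) :
    Run .iteration s (500 * (n + m + N + 1)) fun s' =>
      SameData s s' ∧ Stores (P.next (signedRows B) d t) s' := by
  refine (Run.gather h hP).seq ?_
  rintro s₁ ⟨data₁, hP₁, gradient_eq, weight_eq, payoff_eq⟩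
  refine (Run.boxMove (h.of_sameData data₁) hP₁ (π := P.Y + P.y) gradient_eq weight_eq).seq ?_
  rintro s₂ ⟨data₂, hP₂, payoff_eq₂⟩
  replace data₂ := data₁.trans data₂
  refine (Run.expWeights (h.of_sameData data₂) hP₂ ((data₂.nvar _ (by decide)).trans round_eq)
    (by rw [payoff_eq₂]; exact payoff_eq)).seq ?_
  rintro s₃ ⟨data₃, hP₃⟩
  replace data₃ := data₂.trans data₃
  refine (Run.normalize (h.of_sameData data₃) hP₃
    (y := (P.next (signedRows B) d t).y) fun i => ?_).mono (by omega) ?_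
  · rw [← signedRows_mulVec, ← map_abs_signedRows_mulVec]
    rfl
  · exact fun s₄ ⟨data₄, hP₄⟩ => ⟨data₃.trans data₄, hP₄⟩

end Round

/-! ### Setting up the game -/

section Setup

variable {n m : ℕ} {A : Matrix (Fin n) (Fin m) ℝ} {D : CSC A} {b : Fin n → ℝ} {r ε : ℝ}
  {x₀ : Fin m → ℝ} {s : State}

/-- Stores the entries of `‖A‖⁻¹ • A`, their absolute values, and `r ‖A‖`. -/
def Prog.scaleMatrix : Prog :=
  .seq (.fillMax Reg.absCoeff Reg.entries (.cell Reg.value)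
    (.sub (.const 0) (.cell Reg.value))) <|
  .seq (.scatter Reg.rowSum Reg.rows Reg.entries .row (.cell Reg.absCoeff)) <|
  .seq (.supNorm Reg.norm Reg.rows Reg.rowSum) <|
  .seq (.fill Reg.coeff Reg.entries (.div (.cell Reg.value) (.var Reg.norm))) <|
  .seq (.fill Reg.absCoeff Reg.entries (.div (.cell Reg.absCoeff) (.var Reg.norm))) <|
  .rset Reg.scale (.mul (.var Reg.radius) (.var Reg.norm))

theorem norm_map_abs_mulVec_one {I J : Type*} [Fintype I] [Fintype J] (A : Matrix I J ℝ) :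
    ‖A.map abs *ᵥ 1‖ = ‖A‖ := by
  rw [Matrix.linfty_opNorm_def, Pi.norm_def]
  congr! 3 with i
  have sum_abs : (A.map abs *ᵥ 1) i = ∑ j, |A i j| := by simp [Matrix.mulVec, dotProduct]
  rw [← NNReal.coe_inj, coe_nnnorm, sum_abs,
    Real.norm_of_nonneg (Finset.sum_nonneg fun j _ => abs_nonneg (A i j))]
  simp

theorem map_abs_inv_smul {I J : Type*} (A : Matrix I J ℝ) {c : ℝ} (hc : 0 ≤ c) :
    (c⁻¹ • A).map abs = c⁻¹ • A.map abs := by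
  ext i j
  simp [abs_mul, abs_of_nonneg hc]

theorem Run.scaleMatrix (h : Indexed D b r ε x₀ s) :
    Run .scaleMatrix s (200 * (n + nnz A + 1)) fun s' => Input D b r ε x₀ s' ∧
      Coords (‖A‖⁻¹ • A) (nnz A) s' ∧ s'.rvar Reg.scale = r * ‖A‖ := by
  refine (Run.fillMax h.entries (by decide) D.val (fun k => -D.val k)
    fun k g _ _ => by simp [h.value]).seq ?_
  rintro _ ⟨absVal, rfl, absVal_eq⟩
  have list : IsCoordList A (nnz A) D.rowIdx (s.narr Reg.colIdx) D.val :=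
    D.isCoordList_map h.colIdx (f := id) rfl
  have absList : IsCoordList (A.map abs) (nnz A) D.rowIdx (s.narr Reg.colIdx) absVal :=
    (D.isCoordList_map h.colIdx abs_zero).congr absVal_eq
  refine (Run.scatter (by exact h.rows) (by decide) (by exact h.entries) (by decide) D.rowIdx
    (fun k => absVal k * 1) (fun k g _ => by simp [h.rowIdx]) fun k g _ => by simp).seq ?_
  rintro _ ⟨rowSum, rfl, rowSum_eq⟩
  refine (Run.supNorm (by exact h.rows) (by decide)).seq ?_
  rintro _ rfl
  have norm_eq : ‖fun i : Fin n => rowSum i‖ = ‖A‖ := by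
    rw [← norm_map_abs_mulVec_one]
    exact congrArg norm (funext fun i => (rowSum_eq i i.2).trans (absList.sum_row (fun _ => 1) i))
  refine (Run.fill (by exact h.entries) (by decide) (fun k => D.val k / ‖A‖)
    fun k g _ _ => by simp [h.value, norm_eq]).seq ?_
  rintro _ ⟨coeff, rfl, coeff_eq⟩
  refine (Run.fill (by exact h.entries) (by decide) (fun k => absVal k / ‖A‖)
    fun k g _ hg => by simp_all).seq ?_
  rintro _ ⟨absCoeff, rfl, absCoeff_eq⟩
  refine (Run.rset ?_).mono (by simp only [NExp.cost, RExp.cost]; omega) fun _ => id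
  refine ⟨{h with}, ⟨h.rows, h.cols, h.entries, ?_, ?_⟩, ?_⟩
  · exact h.rowIdx ▸ list.inv_smul coeff_eq
  · rw [map_abs_inv_smul A (norm_nonneg A)]
    exact h.rowIdx ▸ absList.inv_smul absCoeff_eq
  · simp [h.radius, norm_eq]

/-- Stores the offsets for `scaledRhs`; the array `payoff` serves as scratch space for `B x₀`. -/
def Prog.computeOffsets : Prog :=
  .seq (.scatter Reg.payoff Reg.rows Reg.entries .row
    (.mul (.cell Reg.coeff) (.get Reg.start .col))) <|
  .seq (.fill Reg.scaledRhs Reg.rows (.sub (.div (.cell Reg.rhs) (.var Reg.scale))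
    (.div (.cell Reg.payoff) (.var Reg.radius)))) <|
  .seq (.supNorm Reg.rhsNorm Reg.rows Reg.scaledRhs) <|
  .seq (.fillMax Reg.upperOffset Reg.rows
    (.sub (.sub (.const 0) (.cell Reg.scaledRhs)) (.var Reg.rhsNorm))
    (.sub (.const 0) (.const 2))) <|
  .fillMax Reg.lowerOffset Reg.rows
    (.sub (.cell Reg.scaledRhs) (.var Reg.rhsNorm)) (.sub (.const 0) (.const 2))

theorem Run.computeOffsets (input : Input D b r ε x₀ s) (h : Coords (‖A‖⁻¹ • A) (nnz A) s)
    (scale_eq : s.rvar Reg.scale = r * ‖A‖) :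
    Run .computeOffsets s (200 * (n + nnz A + 1)) fun s' => Input D b r ε x₀ s' ∧
      Ready (‖A‖⁻¹ • A) (offsets (scaledRhs A b r x₀)) (nnz A) s' ∧
      s'.rvar Reg.scale = r * ‖A‖ := by
  refine (Run.scatter h.rows (by decide) h.entries (by decide) (s.narr Reg.rowIdx)
    (fun k => s.rarr Reg.coeff k * s.rarr Reg.start (s.narr Reg.colIdx k))
    (fun k g _ => by simp) fun k g _ => by simp).seq ?_
  rintro _ ⟨product, rfl, product_eq⟩
  refine (Run.fill (by exact h.rows) (by decide)
    (fun i => s.rarr Reg.rhs i / (r * ‖A‖) - product i / r)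
    fun k g _ _ => by simp [scale_eq, input.radius]).seq ?_
  rintro _ ⟨rhs, rfl, rhs_eq⟩
  have rhs_eq_scaledRhs : (fun i : Fin n => rhs i) = scaledRhs A b r x₀ := by
    funext i
    have product_eq' : product i = ((‖A‖⁻¹ • A) *ᵥ x₀) i := by
      refine ((product_eq i i.2).trans (h.coeff.sum_row (s.rarr Reg.start) i)).trans ?_
      simp only [input.start]
    rw [rhs_eq i i.2, product_eq', input.rhs, Matrix.smul_mulVec, scaledRhs, Pi.smul_apply,
      Pi.smul_apply, Pi.sub_apply, smul_eq_mul, smul_eq_mul, mul_inv]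
    ring
  refine (Run.supNorm (by exact h.rows) (by decide)).seq ?_
  rintro _ rfl
  refine (Run.fillMax (by exact h.rows) (by decide)
    (fun i => -rhs i - ‖fun i : Fin n => rhs i‖) (fun _ => -2) fun k g _ _ => by simp).seq ?_
  rintro _ ⟨upper, rfl, upper_eq⟩
  refine (Run.fillMax (by exact h.rows) (by decide)
    (fun i => rhs i - ‖fun i : Fin n => rhs i‖) (fun _ => -2) fun k g _ _ => by simp).mono
    (by simp only [NExp.cost, RExp.cost]; omega) ?_
  rintro _ ⟨lower, rfl, lower_eq⟩
  rw [← rhs_eq_scaledRhs]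
  exact ⟨{input with}, {h with
    upperOffset := fun i => upper_eq i i.2, lowerOffset := fun i => lower_eq i i.2}, scale_eq⟩

/-- Enough iterations for an `ε`-approximate minimizer. -/
noncomputable def numRounds (A : Matrix (Fin n) (Fin m) ℝ) (r ε : ℝ) : ℕ :=
  ⌈(30 + 120 * Real.log (2 * n)) * (r * ‖A‖) / ε⌉₊

/-- Computes `numRounds` by counting, as the machine does not round reals. -/
def Prog.countRounds : Prog :=
  .seq (.rset Reg.temp (.div (.mul (.add (.const 30) (.mul (.const 120)
    (.log (.mul (.const 2) (.ofNat (.var Reg.rows)))))) (.var Reg.scale)) (.var Reg.accuracy))) <|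
  .seq (.nset Reg.rounds (.lit 0)) <|
  .loop (.rlt (.ofNat (.var Reg.rounds)) (.var Reg.temp))
    (.nset Reg.rounds (.add (.var Reg.rounds) (.lit 1)))

theorem Run.countRounds (input : Input D b r ε x₀ s)
    (scale_eq : s.rvar Reg.scale = r * ‖A‖) :
    Run .countRounds s (10 * numRounds A r ε + 30) fun s' =>
      ∃ v, s' = (s.rset Reg.temp v).nset Reg.rounds (numRounds A r ε) := by
  set bound := (30 + 120 * Real.log (2 * n)) * (r * ‖A‖) / ε with bound_def
  refine (Run.rset (Q := (· = s.rset Reg.temp bound)) ?_).seq ?_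
  · simp [input.rows, input.accuracy, scale_eq, bound_def]
  rintro _ rfl
  refine (Run.nset (Q := (· = (s.rset Reg.temp bound).nset Reg.rounds 0)) rfl).seq ?_
  rintro _ rfl
  refine (Run.loop (fun k s' => s' = (s.rset Reg.temp bound).nset Reg.rounds k)
    (numRounds A r ε) (c := 4) ?_ ?_ (Nat.zero_le _) rfl).mono
    (by simp only [Test.cost, NExp.cost, RExp.cost]; omega) fun s' hs' => ⟨bound, hs'⟩
  · rintro k _ - rfl
    simp [Test.Holds, numRounds, Nat.lt_ceil, bound_def]
  · rintro k _ - rfl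
    exact (Run.nset (by simp)).mono (by simp [NExp.cost]) fun _ => id

/-- Stores the initial state of `play`: the center of the box and the uniform weights. -/
def Prog.initStrategies : Prog :=
  .seq (.fill Reg.x Reg.cols (.const 0)) <|
  .seq (.fill Reg.X Reg.cols (.const 0)) <|
  .seq (.fill Reg.yUpper Reg.rows
    (.div (.const 1) (.mul (.const 2) (.ofNat (.var Reg.rows))))) <|
  .seq (.fill Reg.yLower Reg.rows
    (.div (.const 1) (.mul (.const 2) (.ofNat (.var Reg.rows))))) <|
  .fill Reg.YDiff Reg.rows (.const 0)

theorem Run.initStrategies (rows : s.nvar Reg.rows = n) (cols : s.nvar Reg.cols = m) :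
    Run .initStrategies s (100 * (n + m + 1)) fun s' => SameData s s' ∧
      Stores (⟨0, softmax 0, 0, 0⟩ : Play (Fin n ⊕ Fin n) (Fin m)) s' := by
  refine (Run.fill cols (by decide) (fun _ => 0) fun k g _ _ => by simp).seq ?_
  rintro _ ⟨x, rfl, x_eq⟩
  refine (Run.fill (by exact cols) (by decide) (fun _ => 0) fun k g _ _ => by simp).seq ?_
  rintro _ ⟨X, rfl, X_eq⟩
  refine (Run.fill (by exact rows) (by decide) (fun _ => 1 / (2 * (n : ℝ)))
    fun k g _ _ => by simp [rows]).seq ?_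
  rintro _ ⟨yUpper, rfl, yUpper_eq⟩
  refine (Run.fill (by exact rows) (by decide) (fun _ => 1 / (2 * (n : ℝ)))
    fun k g _ _ => by simp [rows]).seq ?_
  rintro _ ⟨yLower, rfl, yLower_eq⟩
  refine (Run.fill (by exact rows) (by decide) (fun _ => 0) fun k g _ _ => by simp).mono
    (by simp only [NExp.cost, RExp.cost]; omega) ?_
  rintro _ ⟨YDiff, rfl, YDiff_eq⟩
  have softmax_zero (i : Fin n ⊕ Fin n) : softmax 0 i = 1 / (2 * (n : ℝ)) := by
    simp [softmax, two_mul]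
  refine ⟨((((sameData_write _ (by decide) _ _).trans (sameData_write _ (by decide) _ _)).trans
    (sameData_write _ (by decide) _ _)).trans (sameData_write _ (by decide) _ _)).trans
    (sameData_write _ (by decide) _ _), fun j => x_eq j j.2, fun j => X_eq j j.2,
    fun i => (yUpper_eq i i.2).trans (softmax_zero _).symm,
    fun i => (yLower_eq i i.2).trans (softmax_zero _).symm,
    fun i => (YDiff_eq i i.2).trans (sub_self 0).symm⟩

end Setup

/-! ### The algorithm -/

section Solver

variable {n m c : ℕ} {A : Matrix (Fin n) (Fin m) ℝ} {D : CSC A} {b : Fin n → ℝ} {r ε : ℝ}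
  {x₀ : Fin m → ℝ} {s : State}

/-- Reads the input and sets up the game. -/
def Prog.prepare : Prog :=
  .seq .findCols (.seq .scaleMatrix (.seq .computeOffsets (.seq .countRounds .initStrategies)))

/-- Plays the game and reads off the approximate minimizer. -/
def Prog.playGame : Prog :=
  .seq (.forLoop Reg.round Reg.rounds .iteration) <|
  .fill Reg.result Reg.cols (.add (.cell Reg.start)
    (.mul (.var Reg.radius) (.div (.cell Reg.X) (.ofNat (.var Reg.rounds)))))

/-- The approximate solution of box-constrained `ℓ∞` regression. -/
def Prog.solver : Prog := .seq .prepare .playGame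

/-- The game is in memory in its state after `t` rounds, together with the data needed to scale
the solution back. -/
structure Playing (A : Matrix (Fin n) (Fin m) ℝ) (b : Fin n → ℝ) (r ε : ℝ) (x₀ : Fin m → ℝ)
    (t : ℕ) (s : State) : Prop where
  radius : s.rvar Reg.radius = r
  start : ∀ j : Fin m, s.rarr Reg.start j = x₀ j
  rounds : s.nvar Reg.rounds = numRounds A r ε
  ready : Ready (‖A‖⁻¹ • A) (offsets (scaledRhs A b r x₀)) (nnz A) s
  stores : Stores (scaledPlay A b r x₀ t) s

theorem Run.prepare (h : Input D b r ε x₀ s) :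
    Run .prepare s (1000 * (n + m + nnz A + 1) + 10 * numRounds A r ε)
      (Playing A b r ε x₀ 0) := by
  refine (Run.findCols h).seq fun s₁ indexed => ?_
  refine (Run.scaleMatrix indexed).seq fun s₂ ⟨input₂, coords, scale₂⟩ => ?_
  refine (Run.computeOffsets input₂ coords scale₂).seq fun s₃ ⟨input₃, ready, scale₃⟩ => ?_
  refine (Run.countRounds input₃ scale₃).seq ?_
  rintro _ ⟨v, rfl⟩
  refine (Run.initStrategies (by exact input₃.rows) (by exact input₃.cols)).mono (by omega) ?_
  rintro s₅ ⟨data, stores⟩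
  exact {
    radius := (data.rvar _ (by decide)).trans input₃.radius
    start := by rw [data.rarr _ (by decide)]; exact input₃.start
    rounds := (data.nvar _ (by decide)).trans (Function.update_self Reg.rounds _ s₃.nvar)
    ready := .of_sameData (by exact {ready with}) data
    stores := stores }

theorem Run.playGame (h : Playing A b r ε x₀ 0 s) :
    Run .playGame s (1000 * (n + m + nnz A + 1) * (numRounds A r ε + 1)) fun s' =>
      output m s' = x₀ + r • ((numRounds A r ε : ℕ) : ℝ)⁻¹ •
        (scaledPlay A b r x₀ (numRounds A r ε)).X := by
  refine (Run.forLoop (fun t s' => s'.nvar Reg.round = t ∧ Playing A b r ε x₀ t s')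
    ?registers ?start ?step (N := numRounds A r ε) (c := 500 * (n + m + nnz A + 1))).seq ?_
  case registers => exact fun t s' ⟨round, playing⟩ => ⟨round, playing.rounds⟩
  case start => exact ⟨rfl, {h with ready := {h.ready with}, stores := {h.stores with}}⟩
  case step =>
    rintro t s' - ⟨round, h'⟩
    refine (Run.iteration h'.ready h'.stores round).mono le_rfl fun s'' ⟨data, stores⟩ => ?_
    have ready := h'.ready.of_sameData data
    exact ⟨(data.nvar _ (by decide)).trans round, rfl, {
      radius := (data.rvar _ (by decide)).trans h'.radius
      start := fun j => (congrFun (data.rarr _ (by decide)) j).trans (h'.start j)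
      rounds := (data.nvar _ (by decide)).trans h'.rounds
      ready := {ready with}
      stores := {stores with} }⟩
  rintro s' ⟨-, h'⟩
  refine (Run.fill h'.ready.cols (by decide)
    (fun j => s'.rarr Reg.start j + r * (s'.rarr Reg.X j / numRounds A r ε))
    fun k g _ _ => by simp [h'.radius, h'.rounds]).mono ?time ?_
  case time =>
    simp only [RExp.cost, NExp.cost]
    have := Nat.zero_le (numRounds A r ε * (n + m + nnz A))
    exact Nat.le_sub_of_add_le (by linarith)
  rintro _ ⟨result, rfl, result_eq⟩
  funext j
  refine (result_eq j j.2).trans ?_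
  rw [h'.start, h'.stores.X, div_eq_inv_mul]
  rfl

theorem norm_pos_of_nnz_pos (h : 0 < nnz A) : 0 < ‖A‖ := by
  refine norm_pos_iff.2 fun hA => h.ne' ?_
  simp [nnz, colNnz, hA]

theorem Run.solver (hn : 0 < n) (hA : 0 < nnz A) (hr : 0 < r) (hε : 0 < ε)
    (h : Input D b r ε x₀ s) :
    Run .solver s (3000 * (n + m + nnz A + 1) * (numRounds A r ε + 1)) fun s' =>
      IsApproxMin (fun x => ‖A *ᵥ x - b‖) {x | ∀ j, |x j - x₀ j| ≤ r} ε (output m s') := by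
  refine (Run.prepare h).seq fun s₁ playing => ?_
  refine (Run.playGame playing).mono ?time fun s' output_eq => ?_
  case time =>
    have := Nat.zero_le (numRounds A r ε * (n + m + nnz A))
    exact Nat.le_sub_of_add_le (by linarith)
  have : Nonempty (Fin n) := ⟨⟨0, hn⟩⟩
  have norm_pos := norm_pos_of_nnz_pos hA
  have log_nonneg : 0 ≤ Real.log (2 * n) := by
    exact_mod_cast Real.log_natCast_nonneg (2 * n)
  rw [output_eq]
  refine isApproxMin_add_smul_average norm_pos b hr hε x₀ (Nat.ceil_pos.2 (by positivity)) ?_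
  rw [Fintype.card_fin]
  exact Nat.le_ceil _

/-! ### Running time -/

theorem nnz_le (hc : ∀ j, colNnz A j ≤ c) : nnz A ≤ m * c := by
  simpa [nnz] using Finset.sum_le_card_nsmul Finset.univ (colNnz A) c fun j _ => hc j

theorem size_le (hn : 0 < n) (hnnz : n ≤ nnz A) (hc : ∀ j, colNnz A j ≤ c) :
    n + m + nnz A + 1 ≤ 4 * (m * c) := by
  have nnz_le := nnz_le hc
  have m_le : m ≤ m * c := Nat.le_mul_of_pos_right m <| Nat.pos_of_ne_zero fun h => by
    rw [h, mul_zero] at nnz_le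
    omega
  omega

theorem one_le_log_two_add {f : ℝ} (hf : 1 ≤ f) : 1 ≤ Real.log (2 + f) := by
  rw [Real.le_log_iff_exp_le (by linarith)]
  linarith [Real.exp_one_lt_d9]

theorem log_two_mul_le_two_mul_log {a f : ℝ} (ha : 1 ≤ a) (haf : a ≤ f) :
    Real.log (2 * a) ≤ 2 * Real.log (2 + f) :=
  calc Real.log (2 * a) ≤ Real.log ((2 + f) ^ 2) :=
        Real.log_le_log (by linarith) (by nlinarith)
    _ = 2 * Real.log (2 + f) := by rw [Real.log_pow, Nat.cast_ofNat]

theorem numRounds_add_one_le (hn : 0 < n) (A : Matrix (Fin n) (Fin m) ℝ) (hr : 0 < r) (hε : 0 < ε)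
    {f : ℝ} (hf : n ≤ f) :
    (numRounds A r ε : ℝ) + 1 ≤ 272 * Real.log (2 + f) * max 1 (r * ‖A‖ / ε) := by
  have one_le_n : (1 : ℝ) ≤ n := by exact_mod_cast hn
  have one_le_log := one_le_log_two_add (one_le_n.trans hf)
  have log_le := log_two_mul_le_two_mul_log one_le_n hf
  have log_nonneg : 0 ≤ Real.log (2 * n) := Real.log_nonneg (by linarith)
  have rounds_lt := Nat.ceil_lt_add_one
    (a := (30 + 120 * Real.log (2 * n)) * (r * ‖A‖) / ε) (by positivity)
  have bound_le : (30 + 120 * Real.log (2 * n)) * (r * ‖A‖) / ε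
      ≤ 270 * Real.log (2 + f) * max 1 (r * ‖A‖ / ε) := by
    rw [mul_div_assoc]
    exact mul_le_mul (by linarith) (le_max_right _ _) (by positivity) (by positivity)
  have one_le := one_le_mul_of_one_le_of_one_le one_le_log (le_max_left 1 (r * ‖A‖ / ε))
  rw [numRounds]
  linarith

theorem time_le_softBound (hn : 0 < n) (hnnz : n ≤ nnz A) (hc : ∀ j, colNnz A j ≤ c)
    (hr : 0 < r) (hε : 0 < ε) :
    ((3000 * (n + m + nnz A + 1) * (numRounds A r ε + 1) : ℕ) : ℝ)
      ≤ softBound 3264000 1 (m * c * max 1 (r * ‖A‖ / ε)) := by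
  set f : ℝ := m * c * max 1 (r * ‖A‖ / ε) with f_def
  have n_le_f : (n : ℝ) ≤ f := by
    have : (n : ℝ) ≤ m * c := by exact_mod_cast hnnz.trans (nnz_le hc)
    exact this.trans (le_mul_of_one_le_right (by positivity) (le_max_left _ _))
  have size_le : ((n + m + nnz A + 1 : ℕ) : ℝ) ≤ 4 * (m * c) := by
    exact_mod_cast size_le hn hnnz hc
  calc ((3000 * (n + m + nnz A + 1) * (numRounds A r ε + 1) : ℕ) : ℝ)
      = 3000 * ((n + m + nnz A + 1 : ℕ) : ℝ) * ((numRounds A r ε : ℝ) + 1) := by push_cast; ring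
    _ ≤ 3000 * (4 * (m * c)) * (272 * Real.log (2 + f) * max 1 (r * ‖A‖ / ε)) := by
        gcongr
        exact numRounds_add_one_le hn A hr hε n_le_f
    _ = softBound 3264000 1 f := by rw [softBound, f_def]; ring

end Solver

theorem Run.solvesWithin {p : Prog} {init : (ℕ → unitInterval) → State} {T : ℕ} {T' : ℝ}
    {Good : State → Prop} (h : ∀ ω, Run p (init ω) T Good) (hT : (T : ℝ) ≤ T') :
    SolvesWithin p init T' 0 Good := by
  choose s' t exec time_le good using h
  refine ⟨fun ω => ⟨s' ω, t ω, exec ω, (Nat.cast_le.2 (time_le ω)).trans hT⟩, ?_⟩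
  have no_failure : {ω | ¬ ∃ s' t, Exec p (init ω) s' t ∧ Good s'} = ∅ :=
    Set.eq_empty_of_forall_notMem fun ω failure => failure ⟨s' ω, t ω, exec ω, good ω⟩
  rw [no_failure, measure_empty]

theorem SolvesWithin.mono {p : Prog} {init : (ℕ → unitInterval) → State} {T : ℝ} {δ δ' : ENNReal}
    {Good Good' : State → Prop} (h : SolvesWithin p init T δ Good) (hδ : δ ≤ δ')
    (hGood : ∀ s, Good s → Good' s) : SolvesWithin p init T δ' Good' :=
  ⟨h.1, (measure_mono fun _ hω ⟨s', t, exec, good⟩ => hω ⟨s', t, exec, hGood s' good⟩).trans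
    (h.2.trans hδ)⟩

theorem IsApproxMin.univ_of_isMinOn {X : Type*} {f : X → ℝ} {S : Set X} {ε : ℝ} {x xopt : X}
    (h : IsApproxMin f S ε x) (hopt : IsMinOn f Set.univ xopt) (hS : xopt ∈ S) :
    IsApproxMin f Set.univ ε x :=
  ⟨Set.mem_univ x, fun _ hy => (h.2 xopt hS).trans (add_le_add_left (hopt hy) ε)⟩

theorem abs_sub_le_of_norm_sub_le {J : Type*} [Fintype J] {x y : J → ℝ} {r : ℝ}
    (h : ‖x - y‖ ≤ r) (j : J) : |y j - x j| ≤ r := by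
  rw [abs_sub_comm]
  exact (norm_le_pi_norm (x - y) j).trans h

end LinfReg

theorem mainTheorem9_general :
    ∃ (p : LinfReg.Prog) (C : ℝ) (k : ℕ),
      ∀ (n m c : ℕ) (A : Matrix (Fin n) (Fin m) ℝ) (D : LinfReg.CSC A) (b : Fin n → ℝ) (r ε : ℝ)
        (x₀ : Fin m → ℝ),
        0 < n → n ≤ LinfReg.nnz A → (∀ j, LinfReg.colNnz A j ≤ c) → 0 < r → 0 < ε →
        LinfReg.SolvesWithin p (LinfReg.initState D b r ε x₀)
          (LinfReg.softBound C k (m * c * max 1 (r * ‖A‖ / ε))) 0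
          (fun s => LinfReg.IsApproxMin (fun x : Fin m → ℝ => ‖A *ᵥ x - b‖)
            {x | ∀ j, |x j - x₀ j| ≤ r} ε (LinfReg.output m s)) :=
  open LinfReg in
  ⟨.solver, 3264000, 1, fun _ _ _ _ _ _ _ _ _ hn hnnz hc hr hε => Run.solvesWithin
    (fun ω => Run.solver hn (hn.trans_le hnnz) hr hε (input_initState ω))
    (time_le_softBound hn hnnz hc hr hε)⟩

theorem mainTheorem9 (K : ℕ) :
    (∃ (p : LinfReg.Prog) (C : ℝ) (k : ℕ),
      ∀ (n m c : ℕ) (A : Matrix (Fin n) (Fin m) ℝ) (D : LinfReg.CSC A) (b : Fin n → ℝ) (r ε : ℝ),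
        0 < n → n ≤ LinfReg.nnz A → (∀ j, LinfReg.colNnz A j ≤ c) → 0 < r → 0 < ε →
        LinfReg.SolvesWithin p (LinfReg.initState D b r ε 0)
          (LinfReg.softBound C k (m * c * max 1 (r * ‖A‖ / ε)))
          (ENNReal.ofReal (((n : ℝ) + m) ^ K)⁻¹)
          (fun s => LinfReg.IsApproxMin (fun x : Fin m → ℝ => ‖A *ᵥ x - b‖)
            {x | ∀ j, x j ∈ Set.Icc (-r) r} ε (LinfReg.output m s))) ∧
    (∃ (p : LinfReg.Prog) (C : ℝ) (k : ℕ),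
      ∀ (n m c : ℕ) (A : Matrix (Fin n) (Fin m) ℝ) (D : LinfReg.CSC A) (b : Fin n → ℝ) (r ε : ℝ)
        (x₀ xopt : Fin m → ℝ),
        0 < n → n ≤ LinfReg.nnz A → (∀ j, LinfReg.colNnz A j ≤ c) → 0 < r → 0 < ε →
        IsMinOn (fun x : Fin m → ℝ => ‖A *ᵥ x - b‖) Set.univ xopt → ‖x₀ - xopt‖ ≤ r →
        LinfReg.SolvesWithin p (LinfReg.initState D b r ε x₀)
          (LinfReg.softBound C k (m * c * max 1 (r * ‖A‖ / ε)))
          (ENNReal.ofReal (((n : ℝ) + m) ^ K)⁻¹)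
          (fun s => LinfReg.IsApproxMin (fun x : Fin m → ℝ => ‖A *ᵥ x - b‖)
            Set.univ ε (LinfReg.output m s))) := by
  obtain ⟨p, C, k, solves⟩ := mainTheorem9_general
  refine ⟨⟨p, C, k, fun n m c A D b r ε hn hnnz hc hr hε => ?_⟩,
    ⟨p, C, k, fun n m c A D b r ε x₀ xopt hn hnnz hc hr hε hopt hx₀ => ?_⟩⟩
  · simpa only [Pi.zero_apply, sub_zero, abs_le, Set.mem_Icc] using
      (solves n m c A D b r ε 0 hn hnnz hc hr hε).mono zero_le fun _ => id
  · exact (solves n m c A D b r ε x₀ hn hnnz hc hr hε).mono zero_le fun _ h =>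
      h.univ_of_isMinOn hopt (LinfReg.abs_sub_le_of_norm_sub_le hx₀)
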